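/- Let $d\ge 1$ and $n\ge 0$ be integers, let $\xi_1,\dots,\xi_d$ be the complex $d$-th roots of unity in some order, and let $R=\mathbb{C}[u^{\pm1},v]$ with $u,v$ indeterminates. Write $s_i=(i,i+1)\in\mathfrak{S}_n$, and $\ell$ for the length on $\mathfrak{S}_n$ with respect to $s_1,\dots,s_{n-1}$. **Algebras.** The Iwahori–Hecke algebra $\mathcal{H}_n$ is the unital associative $R$-algebra with generators $T_1,\dots,T_{n-1}$ and relations $T_iT_j=T_jT_i$ for $|i-j|>1$, $T_iT_{i+1}T_i=T_{i+1}T_iT_{i+1}$, and $T_i^2=u^2+vT_i$. The Yokonuma–Hecke algebra $Y_{d,n}$ is the unital associative $R$-algebra with generators $g_1,\dots,g_{n-1},t_1,\dots,t_n$ and relations $g_ig_j=g_jg_i$ for $|i-j|>1$, $g_ig_{i+1}g_i=g_{i+1}g_ig_{i+1}$, $t_it_j=t_jt_i$, $g_it_j=t_{s_i(j)}g_i$, $t_j^d=1$, and $g_i^2=u^2+v\,e_ig_i$, where $e_i=\frac1d\sum_{r=0}^{d-1}t_i^r t_{i+1}^{-r}$. For $w\in\mathfrak{S}_n$ with reduced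 expression $w=s_{i_1}\cdots s_{i_r}$, put $\widetilde T_w=u^{-\ell(w)}T_{i_1}\cdots T_{i_r}$ and $\widetilde g_w=u^{-\ell(w)}g_{i_1}\cdots g_{i_r}$. **Compositions.** Let $\mathrm{Comp}_d(n)$ be the set of $\mu=(\mu_1,\dots,\mu_d)\in\mathbb{Z}_{\ge0}^d$ with $\sum_a\mu_a=n$. Cut $\{1,\dots,n\}$ into consecutive blocks of sizes $\mu_1,\dots,\mu_d$. Let $\mathfrak{S}^\mu=\mathfrak{S}_{\mu_1}\times\cdots\times\mathfrak{S}_{\mu_d}$ be the Young subgroup preserving the blocks, and let $\mathcal{H}^\mu\subseteq\mathcal{H}_n$ be the subalgebra generated by the $T_i$ with $i,i+1$ in the same block. **Characters and idempotents.** A complex character $\chi$ of $(\mathbb{Z}/d\mathbb{Z})^n$ is identified with the tuple $(\chi(t_1),\dots,\chi(t_n))$ of $d$-th roots of unity, and $\mathfrak{S}_n$ acts by $w(\chi)(t_i)=\chi(t_{w^{-1}(i)})$. Put $E_\chi=\prod_{i=1}^n\bigl(\frac1d\sum_{r=0}^{d-1}\chi(t_i)^rt_i^{-r}\bigr)\in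 Y_{d,n}$. Let $\mathcal{O}(\mu)$ be the set of $\chi$ taking each value $\xi_a$ exactly $\mu_a$ times on $t_1,\dots,t_n$, and put $m_\mu=\#\mathcal{O}(\mu)$ and $E_\mu=\sum_{\chi\in\mathcal{O}(\mu)}E_\chi$. Let $\chi^\mu_1\in\mathcal{O}(\mu)$ be the character with $\chi_1^\mu(t_i)=\xi_a$ for $i$ in the $a$-th block. Let $\pi_{1,\mu}=1,\pi_{2,\mu},\dots,\pi_{m_\mu,\mu}$ be any enumeration of the minimal length representatives of the left cosets in $\mathfrak{S}_n/\mathfrak{S}^\mu$, and put $\chi^\mu_k=\pi_{k,\mu}(\chi^\mu_1)$. Write $M_{i,j}$ for elementary matrices. **Theorem.** The elements $\widetilde T_w$ and $\widetilde g_w$ do not depend on the reduced expression of $w$, and for every $\mu\in\mathrm{Comp}_d(n)$: 1. $m_\mu=\dfrac{n!}{\mu_1!\cdots\mu_d!}$ and $\mathcal{O}(\mu)=\{\chi_1^\mu,\dots,\chi_{m_\mu}^\mu\}$, without repetition. There is an isomorphism of $R$-algebras $\mathcal{H}_{\mu_1}\otimes_R\cdots\otimes_R\mathcal{H}_{\mu_d}\cong\mathcal{H}^\mu$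 sending the generator $T_i$ of the $a$-th factor to $T_{\mu_1+\cdots+\mu_{a-1}+i}$. 2. $\{\widetilde T_w\mid w\in\mathfrak{S}^\mu\}$ is an $R$-basis of $\mathcal{H}^\mu$, and $\{E_{\chi^\mu_k}\widetilde g_w\mid 1\le k\le m_\mu,\ w\in\mathfrak{S}_n\}$ is an $R$-basis of $E_\mu Y_{d,n}$. 3. Let $\Phi_\mu:\mathrm{Mat}_{m_\mu}(\mathcal{H}^\mu)\to E_\mu Y_{d,n}$ and $\Psi_\mu:E_\mu Y_{d,n}\to\mathrm{Mat}_{m_\mu}(\mathcal{H}^\mu)$ be the $R$-linear maps with $$\Phi_\mu(\widetilde T_w M_{i,j})=E_{\chi_i^\mu}\,\widetilde g_{\pi_{i,\mu}w\pi_{j,\mu}^{-1}}\,E_{\chi_j^\mu}\quad(w\in\mathfrak{S}^\mu),\qquad \Psi_\mu(E_{\chi_k^\mu}\widetilde g_w)=\widetilde T_{\pi_{k,\mu}^{-1}w\pi_{j,\mu}}M_{k,j}\quad(w\in\mathfrak{S}_n),$$ where in the second formula $j$ is the unique index with $w(\chi_j^\mu)=\chi_k^\mu$; for this $j$ one has $\pi_{k,\mu}^{-1}w\pi_{j,\mu}\in\mathfrak{S}^\mu$.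 Then $\Phi_\mu$ is an isomorphism of $R$-algebras, where $E_\mu Y_{d,n}$ has unit $E_\mu$, and its inverse is $\Psi_\mu$. Moreover, the map $\Phi_n=\bigoplus_\mu\Phi_\mu:\bigoplus_{\mu\in\mathrm{Comp}_d(n)}\mathrm{Mat}_{m_\mu}(\mathcal{H}^\mu)\to Y_{d,n}$, $(x_\mu)_\mu\mapsto\sum_\mu\Phi_\mu(x_\mu)$, is an isomorphism of $R$-algebras, with inverse $\Psi_n:y\mapsto(\Psi_\mu(E_\mu y))_\mu$. -/

import Mathlib

open scoped TensorProduct Nat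

namespace YokonumaHecke

noncomputable section

/-! ### The ground ring -/

/-- The ground ring `ℂ[u^{±1}, v]`: polynomials in `v` over Laurent polynomials in `u`. -/
def K : Type := Polynomial (LaurentPolynomial ℂ)

instance : CommRing K := inferInstanceAs (CommRing (Polynomial (LaurentPolynomial ℂ)))

/-- The indeterminate `u`. -/
def u : K := (Polynomial.C (LaurentPolynomial.T 1) : Polynomial (LaurentPolynomial ℂ))

/-- The inverse `u⁻¹` of the indeterminate `u`. -/
def uInv : K := (Polynomial.C (LaurentPolynomial.T (-1)) : Polynomial (LaurentPolynomial ℂ))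

/-- The indeterminate `v`. -/
def v : K := (Polynomial.X : Polynomial (LaurentPolynomial ℂ))

/-- A complex number as a constant of the ground ring. -/
def cst (z : ℂ) : K := (Polynomial.C (LaurentPolynomial.C z) : Polynomial (LaurentPolynomial ℂ))

/-! ### The symmetric group: simple transpositions, length, reduced expressions -/

/-- The simple transposition `(i, i+1)`. Indices start at `0`: the `n - 1` simple transpositions
are indexed by `Fin (n - 1)`, and the letters by `Fin n`. -/
def s {n : ℕ} (i : Fin (n - 1)) : Equiv.Perm (Fin n) :=
  Equiv.swap ⟨i, by omega⟩ ⟨i + 1, by omega⟩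

/-- The permutation expressed by a word in the simple transpositions. -/
def wordProd {n : ℕ} (l : List (Fin (n - 1))) : Equiv.Perm (Fin n) := (l.map s).prod

/-- The length of `w`: the least length of a word in the simple transpositions expressing `w`. -/
def len {n : ℕ} (w : Equiv.Perm (Fin n)) : ℕ :=
  sInf {r | ∃ l : List (Fin (n - 1)), wordProd l = w ∧ l.length = r}

/-- `l` is a reduced expression of `w`. -/
def IsReducedExpr {n : ℕ} (l : List (Fin (n - 1))) (w : Equiv.Perm (Fin n)) : Prop :=
  wordProd l = w ∧ l.length = len w

theorem exists_word {n : ℕ} (w : Equiv.Perm (Fin n)) :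
    ∃ l : List (Fin (n - 1)), wordProd l = w := by
  rcases n with _ | m
  · exact ⟨[], Subsingleton.elim _ _⟩
  · have h : w ∈ Submonoid.closure
        (Set.range fun i : Fin m => Equiv.swap i.castSucc i.succ) := by
      rw [Equiv.Perm.mclosure_swap_castSucc_succ]; trivial
    induction h using Submonoid.closure_induction with
    | mem x hx =>
      obtain ⟨i, rfl⟩ := hx
      exact ⟨[i], by simp only [wordProd, List.map_cons, List.map_nil, List.prod_singleton]; rfl⟩
    | one => exact ⟨[], rfl⟩
    | mul x y _ _ hx hy =>
      obtain ⟨a, ha⟩ := hx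
      obtain ⟨b, hb⟩ := hy
      refine ⟨a ++ b, ?_⟩
      simp only [wordProd, List.map_append, List.prod_append] at *
      rw [ha, hb]

theorem exists_isReducedExpr {n : ℕ} (w : Equiv.Perm (Fin n)) :
    ∃ l : List (Fin (n - 1)), IsReducedExpr l w := by
  obtain ⟨l, hl⟩ := exists_word w
  exact Nat.sInf_mem (s := {r | ∃ l : List (Fin (n - 1)), wordProd l = w ∧ l.length = r})
    ⟨_, l, hl, rfl⟩

/-- A reduced expression of `w`. -/
def reducedExpr {n : ℕ} (w : Equiv.Perm (Fin n)) : List (Fin (n - 1)) :=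
  (exists_isReducedExpr w).choose

/-! ### The Iwahori-Hecke algebra of type `A` -/

/-- The defining relations of the Iwahori-Hecke algebra of type `A_{n-1}`. -/
inductive HeckeRel (n : ℕ) : FreeAlgebra K (Fin (n - 1)) → FreeAlgebra K (Fin (n - 1)) → Prop
  | comm (i j : Fin (n - 1)) (h : (i : ℕ) + 1 < j ∨ (j : ℕ) + 1 < i) :
      HeckeRel n (FreeAlgebra.ι K i * FreeAlgebra.ι K j) (FreeAlgebra.ι K j * FreeAlgebra.ι K i)
  | braid (i j : Fin (n - 1)) (h : (i : ℕ) + 1 = j) :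
      HeckeRel n (FreeAlgebra.ι K i * FreeAlgebra.ι K j * FreeAlgebra.ι K i)
        (FreeAlgebra.ι K j * FreeAlgebra.ι K i * FreeAlgebra.ι K j)
  | quad (i : Fin (n - 1)) :
      HeckeRel n (FreeAlgebra.ι K i * FreeAlgebra.ι K i)
        (algebraMap K _ (u ^ 2) + v • FreeAlgebra.ι K i)

/-- The Iwahori-Hecke algebra `H_n` of type `A_{n-1}`; in particular `H_0 = H_1 = ℂ[u^{±1}, v]`. -/
def Hecke (n : ℕ) : Type := RingQuot (HeckeRel n)

instance (n : ℕ) : Ring (Hecke n) := inferInstanceAs (Ring (RingQuot (HeckeRel n)))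

instance (n : ℕ) : Algebra K (Hecke n) := inferInstanceAs (Algebra K (RingQuot (HeckeRel n)))

/-- The generator `T_i` of `H_n`. -/
def T {n : ℕ} (i : Fin (n - 1)) : Hecke n :=
  RingQuot.mkAlgHom K (HeckeRel n) (FreeAlgebra.ι K i)

/-- The product `T_{i_1} ⋯ T_{i_r}` along a word. -/
def wordT {n : ℕ} (l : List (Fin (n - 1))) : Hecke n := (l.map T).prod

/-- The element `T̃_w = u^{-ℓ(w)} T_{i_1} ⋯ T_{i_r}`, for a reduced expression of `w`. -/
def Tt {n : ℕ} (w : Equiv.Perm (Fin n)) : Hecke n := uInv ^ len w • wordT (reducedExpr w)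

/-! ### The Yokonuma-Hecke algebra -/

/-- The generators of the Yokonuma-Hecke algebra: `g_1, …, g_{n-1}` and `t_1, …, t_n`. -/
inductive YGen (n : ℕ) : Type
  | g (i : Fin (n - 1))
  | t (j : Fin n)

namespace Free

/-- The letter `g_i` of the free algebra. -/
def g {n : ℕ} (i : Fin (n - 1)) : FreeAlgebra K (YGen n) := FreeAlgebra.ι K (YGen.g i)

/-- The letter `t_j` of the free algebra. -/
def t {n : ℕ} (j : Fin n) : FreeAlgebra K (YGen n) := FreeAlgebra.ι K (YGen.t j)

/-- The expression `e_i = (1/d) ∑_{0 ≤ r ≤ d-1} t_i^r t_{i+1}^{-r}`.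
Since `t_j^d = 1` is one of the relations, `t_j^{-r}` is written `t_j^{d-r}`. -/
def e (d : ℕ) {n : ℕ} (i : Fin (n - 1)) : FreeAlgebra K (YGen n) :=
  cst (d : ℂ)⁻¹ • ∑ r ∈ Finset.range d,
    t (⟨i, by omega⟩ : Fin n) ^ r * t (⟨i + 1, by omega⟩ : Fin n) ^ (d - r)

end Free

/-- The defining relations of the Yokonuma-Hecke algebra. -/
inductive YRel (d n : ℕ) : FreeAlgebra K (YGen n) → FreeAlgebra K (YGen n) → Prop
  | comm (i j : Fin (n - 1)) (h : (i : ℕ) + 1 < j ∨ (j : ℕ) + 1 < i) :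
      YRel d n (Free.g i * Free.g j) (Free.g j * Free.g i)
  | braid (i j : Fin (n - 1)) (h : (i : ℕ) + 1 = j) :
      YRel d n (Free.g i * Free.g j * Free.g i) (Free.g j * Free.g i * Free.g j)
  | tcomm (i j : Fin n) : YRel d n (Free.t i * Free.t j) (Free.t j * Free.t i)
  | gt (i : Fin (n - 1)) (j : Fin n) :
      YRel d n (Free.g i * Free.t j) (Free.t (s i j) * Free.g i)
  | tpow (j : Fin n) : YRel d n (Free.t j ^ d) 1
  | quad (i : Fin (n - 1)) :
      YRel d n (Free.g i ^ 2) (algebraMap K _ (u ^ 2) + v • (Free.e d i * Free.g i))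

/-- The Yokonuma-Hecke algebra `Y_{d,n}`. -/
def Yok (d n : ℕ) : Type := RingQuot (YRel d n)

instance (d n : ℕ) : Ring (Yok d n) := inferInstanceAs (Ring (RingQuot (YRel d n)))

instance (d n : ℕ) : Algebra K (Yok d n) := inferInstanceAs (Algebra K (RingQuot (YRel d n)))

/-- The generator `g_i` of `Y_{d,n}`. -/
def g (d : ℕ) {n : ℕ} (i : Fin (n - 1)) : Yok d n :=
  RingQuot.mkAlgHom K (YRel d n) (Free.g i)

/-- The generator `t_j` of `Y_{d,n}`. -/
def t (d : ℕ) {n : ℕ} (j : Fin n) : Yok d n :=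
  RingQuot.mkAlgHom K (YRel d n) (Free.t j)

/-- The product `g_{i_1} ⋯ g_{i_r}` along a word. -/
def wordG (d : ℕ) {n : ℕ} (l : List (Fin (n - 1))) : Yok d n := (l.map (g d)).prod

/-- The element `g̃_w = u^{-ℓ(w)} g_{i_1} ⋯ g_{i_r}`, for a reduced expression of `w`. -/
def gt (d : ℕ) {n : ℕ} (w : Equiv.Perm (Fin n)) : Yok d n :=
  uInv ^ len w • wordG d (reducedExpr w)

/-! ### Compositions, Young subgroups, the algebra `H^μ` -/

/-- The set `Comp_d(n)` of compositions of `n` with `d` (possibly zero) parts. -/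
def Comp (d n : ℕ) : Type := {μ : Fin d → ℕ // ∑ a, μ a = n}

instance (d n : ℕ) : Fintype (Comp d n) :=
  Fintype.subtype (Finset.piAntidiag Finset.univ n) (by simp)

/-- The decomposition of the letters into consecutive blocks of sizes `μ_1, …, μ_d`: the pair
`(a, j)` goes to the `j`-th letter of the `a`-th block, that is `μ_1 + ⋯ + μ_{a-1} + j`. -/
def blockEquiv {d n : ℕ} (μ : Comp d n) : (Σ a : Fin d, Fin (μ.1 a)) ≃ Fin n :=
  finSigmaFinEquiv.trans (finCongr μ.2)

/-- The index of the block in which a letter lies. -/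
def block {d n : ℕ} (μ : Comp d n) (i : Fin n) : Fin d := ((blockEquiv μ).symm i).1

/-- The Young subgroup `S^μ = S_{μ_1} × ⋯ × S_{μ_d}`: the permutations preserving each block. -/
def young {d n : ℕ} (μ : Comp d n) : Subgroup (Equiv.Perm (Fin n)) where
  carrier := {w | ∀ i, block μ (w i) = block μ i}
  mul_mem' := fun {a b} ha hb i => (ha (b i)).trans (hb i)
  one_mem' := fun _ => rfl
  inv_mem' := fun {a} ha i => by
    have h := ha (a⁻¹ i)
    have h' : a (a⁻¹ i) = i := by simp
    rw [h'] at h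
    exact h.symm

/-- The set `I_μ` of those `i` such that `i` and `i + 1` lie in the same block, that is of all
indices of simple transpositions except `μ_1, μ_1 + μ_2, …, μ_1 + ⋯ + μ_{d-1}`. -/
def I {d n : ℕ} (μ : Comp d n) : Set (Fin (n - 1)) :=
  {i | block μ ⟨i, by omega⟩ = block μ ⟨i + 1, by omega⟩}

/-- The subalgebra `H^μ` of `H_n` generated by the `T_i` with `i ∈ I_μ`. -/
def Hmu {d n : ℕ} (μ : Comp d n) : Subalgebra K (Hecke n) := Algebra.adjoin K (T '' I μ)

/-! ### Characters and idempotents -/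

/-- A complex character `χ` of `(ℤ/dℤ)^n`, given by the `d`-th roots of unity
`χ(t_1), …, χ(t_n)`. -/
abbrev Chr (d n : ℕ) : Type := Fin n → rootsOfUnity d ℂ

instance (d n : ℕ) [NeZero d] : Fintype (Chr d n) := Fintype.ofFinite _

/-- The action of the symmetric group: `w(χ)(t_i) = χ(t_{w⁻¹(i)})`. -/
def act {d n : ℕ} (w : Equiv.Perm (Fin n)) (χ : Chr d n) : Chr d n := fun i => χ (w⁻¹ i)

/-- The value `χ(t_i)` as a complex number. -/
def val {d n : ℕ} (χ : Chr d n) (i : Fin n) : ℂ := ((χ i : ℂˣ) : ℂ)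

/-- The idempotent `E_χ = ∏_i (1/d) ∑_{0 ≤ r ≤ d-1} χ(t_i)^r t_i^{-r}`, where `t_i^{-r}` is
`t_i^{d-r}`. The factors commute with each other. -/
def E {d n : ℕ} (χ : Chr d n) : Yok d n :=
  (List.ofFn fun i : Fin n =>
    cst (d : ℂ)⁻¹ • ∑ r ∈ Finset.range d, cst (val χ i ^ r) • t d i ^ (d - r)).prod

section

variable {d n : ℕ} (ξ : Fin d ≃ rootsOfUnity d ℂ)

/-- The orbit `O(μ)`: the characters `χ` that take each value `ξ_a` exactly `μ_a` times on
`t_1, …, t_n`. -/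
def orbit (μ : Comp d n) : Set (Chr d n) :=
  {χ | ∀ a, Nat.card {j : Fin n // χ j = ξ a} = μ.1 a}

/-- The number `m_μ` of characters in `O(μ)`. -/
def m (μ : Comp d n) : ℕ := Nat.card (orbit ξ μ)

open scoped Classical in
/-- The central idempotent `E_μ`: the sum of the `E_χ` over `χ ∈ O(μ)`. -/
def Emu [NeZero d] (μ : Comp d n) : Yok d n :=
  ∑ χ ∈ Finset.univ.filter (fun χ : Chr d n => χ ∈ orbit ξ μ), E χ

/-- The character `χ_1^μ`, with value `ξ_a` on the `t_i` with `i` in the `a`-th block. -/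
def chi1 (μ : Comp d n) : Chr d n := fun i => ξ (block μ i)

/-- `π_1, …, π_{m_μ}` are the distinguished (minimal length) representatives of the left cosets
in `S_n / S^μ`, listed in any order such that `π_1 = 1`. -/
structure IsDistinguished (μ : Comp d n) (π : Fin (m ξ μ) → Equiv.Perm (Fin n)) : Prop where
  minimal : ∀ k, ∀ w ∈ young μ, len (π k) ≤ len (π k * w)
  represents : ∀ w, ∃! k, (π k)⁻¹ * w ∈ young μ
  first : ∀ k : Fin (m ξ μ), k.val = 0 → π k = 1

/-- The two-sided ideal `E_μ Y_{d,n} = {E_μ y}` of `Y_{d,n}`, with the operations of `Y_{d,n}`. -/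
def EY [NeZero d] (μ : Comp d n) : NonUnitalSubalgebra K (Yok d n) where
  carrier := Set.range fun y => Emu ξ μ * y
  add_mem' := by
    rintro _ _ ⟨x, rfl⟩ ⟨y, rfl⟩
    exact ⟨x + y, mul_add _ _ _⟩
  zero_mem' := ⟨0, mul_zero _⟩
  mul_mem' := by
    rintro _ _ ⟨x, rfl⟩ ⟨y, rfl⟩
    exact ⟨x * (Emu ξ μ * y), (mul_assoc _ _ _).symm⟩
  smul_mem' := by
    rintro c _ ⟨x, rfl⟩
    exact ⟨c • x, mul_smul_comm _ _ _⟩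

/-- The element `E_μ y` of `E_μ Y_{d,n}`. -/
def toEY [NeZero d] (μ : Comp d n) (y : Yok d n) : EY ξ μ := ⟨Emu ξ μ * y, y, rfl⟩

end

end

end YokonumaHecke

open YokonumaHecke

/-!
The Yokonuma-Hecke algebra is a product of matrix algebras because it can be diagonalized along the
commuting elements `t_j`. The `E_χ` are the joint spectral projections of the `t_j`, they are
orthogonal idempotents with sum `1`, and `g_i` maps the image of `E_χ` to that of `E_{s_i(χ)}`
(`g_mul_E`). As `e_i E_χ` is `E_χ` or `0` according to whether `χ` agrees at `i` and `i + 1`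
(`avg_mul_E`), the quadratic relation for `g_i` is that of the Hecke algebra in the first case, and
`g_i² = u²` in the second case. It follows that the `E_χ g̃_w` span `Y_{d,n}` (`span_E_mul_gt`).

For each `μ` this picture is turned into a representation of `Y_{d,n}` by matrices over `H^μ`
(`IsDistinguished.rep`), with rows and columns indexed by the cosets of the Young subgroup, that is
by `O(μ)`: the element `t_j` is diagonal with entries `χ_k(t_j)`; the row `k` of `g_i` contains the
scalar `u` in the column of `s_i(χ_k)` if this is not `χ_k`, and otherwise the generator of `H^μ`
belonging to the neighbours `π_k⁻¹(i)`, `π_k⁻¹(i+1)` on the diagonal. The relations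
hold since a minimal length representative `π_k` is increasing on each block
(`IsDistinguished.pi_lt`), which also gives `s_i π_k = π_l` whenever `s_i(χ_k) = χ_l ≠ χ_k`
(`IsDistinguished.pi_move_of_ne`). Following a reduced expression of `w` shows that
`E_{χ_k} g̃_w` goes to the matrix with the single entry `T̃_{π_k⁻¹ w π_j}`
(`IsDistinguished.rep_gt`).
So the representations for all `μ` together send a spanning set to a basis of the product of the
matrix algebras, without repetition. They form an isomorphism, whose inverse is the sum of the
linear maps `Φ_μ` (`sum_phi_rep`, `repEquiv`), and the basis of `E_μ Y_{d,n}` comes for free.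

What is needed about `H_n` is the linear independence of the `T̃_w`, obtained from the regular
representation on the free module over the permutations (`regularRep_Tt`), and Matsumoto's theorem
(`prod_map_eq_of_isReducedExpr`), which rests on the description of length by inversions. The
multiplication map `H_{μ_1} ⊗ ⋯ ⊗ H_{μ_d} → H^μ` is surjective between free modules of the same
finite rank `μ_1! ⋯ μ_d!`, hence bijective (`tensorHom_bijective`).
-/

namespace YokonumaHecke

noncomputable section

/-! ### Length and descents in the symmetric group -/

/-- The left one of the two letters moved by the simple transposition `s i`. -/
def lo {n : ℕ} (i : Fin (n - 1)) : Fin n := ⟨i, by omega⟩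

/-- The right one of the two letters moved by the simple transposition `s i`. -/
def hi {n : ℕ} (i : Fin (n - 1)) : Fin n := ⟨i + 1, by omega⟩

section Symmetric

variable {n : ℕ}

@[simp] theorem lo_val (i : Fin (n - 1)) : (lo i : ℕ) = i := rfl

@[simp] theorem hi_val (i : Fin (n - 1)) : (hi i : ℕ) = i + 1 := rfl

theorem s_eq (i : Fin (n - 1)) : s i = Equiv.swap (lo i) (hi i) := rfl

theorem lo_lt_hi (i : Fin (n - 1)) : lo i < hi i := by
  simp [Fin.lt_def]

@[simp] theorem s_lo (i : Fin (n - 1)) : s i (lo i) = hi i := Equiv.swap_apply_left _ _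

@[simp] theorem s_hi (i : Fin (n - 1)) : s i (hi i) = lo i := Equiv.swap_apply_right _ _

theorem s_of_ne {i : Fin (n - 1)} {x : Fin n} (h : x ≠ lo i) (h' : x ≠ hi i) : s i x = x :=
  Equiv.swap_apply_of_ne_of_ne h h'

@[simp] theorem s_inv (i : Fin (n - 1)) : (s i)⁻¹ = s i := Equiv.swap_inv _ _

@[simp] theorem s_mul_self (i : Fin (n - 1)) : s i * s i = 1 := Equiv.swap_mul_self _ _

@[simp] theorem s_s (i : Fin (n - 1)) (x : Fin n) : s i (s i x) = x := Equiv.swap_apply_self _ _ _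

@[simp] theorem s_mul_s_mul (i : Fin (n - 1)) (w : Equiv.Perm (Fin n)) : s i * (s i * w) = w := by
  rw [← mul_assoc, s_mul_self, one_mul]

theorem s_mul_inv_apply (i : Fin (n - 1)) (w : Equiv.Perm (Fin n)) (x : Fin n) :
    (s i * w)⁻¹ x = w⁻¹ (s i x) := by
  rw [mul_inv_rev, s_inv, Equiv.Perm.mul_apply]

theorem apply_inv_apply (w : Equiv.Perm (Fin n)) (x : Fin n) : w (w⁻¹ x) = x :=
  w.apply_symm_apply x

theorem inv_apply_apply (w : Equiv.Perm (Fin n)) (x : Fin n) : w⁻¹ (w x) = x :=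
  w.symm_apply_apply x

/-- A simple transposition reverses the order of no pair but the one it swaps. -/
theorem s_lt_s {i : Fin (n - 1)} {a b : Fin n} (hab : a < b) (h : ¬(a = lo i ∧ b = hi i)) :
    s i a < s i b := by
  have key : ∀ x : Fin n, ((s i x : Fin n) : ℕ) =
      if (x : ℕ) = i then (i : ℕ) + 1 else if (x : ℕ) = i + 1 then i else x := by
    intro x
    by_cases h1 : x = lo i
    · subst h1; simp
    by_cases h2 : x = hi i
    · subst h2; simp
    rw [s_of_ne h1 h2, if_neg (c := (x : ℕ) = i) fun e => h1 (Fin.ext e),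
      if_neg (c := (x : ℕ) = i + 1) fun e => h2 (Fin.ext e)]
  have h' : ¬((a : ℕ) = i ∧ (b : ℕ) = i + 1) := fun e => h ⟨Fin.ext e.1, Fin.ext e.2⟩
  rw [Fin.lt_def, key, key]
  rw [Fin.lt_def] at hab
  split_ifs <;> omega

theorem s_far {i j : Fin (n - 1)} (h : (i : ℕ) + 1 < j ∨ (j : ℕ) + 1 < i) :
    s i (lo j) = lo j ∧ s i (hi j) = hi j := by
  constructor <;> apply s_of_ne <;> simp only [ne_eq, Fin.ext_iff, lo_val, hi_val] <;> omega

theorem hi_eq_lo {i j : Fin (n - 1)} (h : (i : ℕ) + 1 = j) : hi i = lo j := Fin.ext h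

theorem s_hi_adj {i j : Fin (n - 1)} (h : (i : ℕ) + 1 = j) : s i (hi j) = hi j := by
  apply s_of_ne <;> simp only [ne_eq, Fin.ext_iff, lo_val, hi_val] <;> omega

theorem s_lo_adj {i j : Fin (n - 1)} (h : (i : ℕ) + 1 = j) : s j (lo i) = lo i := by
  apply s_of_ne <;> simp only [ne_eq, Fin.ext_iff, lo_val, hi_val] <;> omega

theorem s_comm {i j : Fin (n - 1)} (h : (i : ℕ) + 1 < j ∨ (j : ℕ) + 1 < i) :
    s i * s j = s j * s i := by
  rw [s_eq j, Equiv.mul_swap_eq_swap_mul, (s_far h).1, (s_far h).2]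

theorem s_braid {i j : Fin (n - 1)} (h : (i : ℕ) + 1 = j) :
    s i * s j * s i = s j * s i * s j := by
  have h1 : s i * s j * s i = Equiv.swap (lo i) (hi j) := by
    rw [s_eq j, Equiv.mul_swap_eq_swap_mul, ← hi_eq_lo h, s_hi, s_hi_adj h, mul_assoc, s_mul_self,
      mul_one]
  have h2 : s j * s i * s j = Equiv.swap (lo i) (hi j) := by
    rw [s_eq i, Equiv.mul_swap_eq_swap_mul, hi_eq_lo h, s_lo, s_lo_adj h, mul_assoc, s_mul_self,
      mul_one]
  rw [h1, h2]

/-- A permutation of `Fin n` that increases at each pair of neighbours is the identity. -/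
theorem eq_one_of_lt {w : Equiv.Perm (Fin n)} (h : ∀ i : Fin (n - 1), w (lo i) < w (hi i)) :
    w = 1 := by
  have hm : StrictMono w := by
    rcases n with _ | n
    · exact fun a => a.elim0
    · exact Fin.strictMono_iff_lt_succ.2 fun i => h i
  have := Subsingleton.elim (hm.orderIsoOfSurjective w w.surjective) (OrderIso.refl _)
  ext x
  have h' := congrArg (fun e : Fin n ≃o Fin n => (e x : ℕ)) this
  simpa using h'

/-- The inversions of `w⁻¹`. -/
def invSet (w : Equiv.Perm (Fin n)) : Finset (Fin n × Fin n) :=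
  Finset.univ.filter fun p => p.1 < p.2 ∧ w⁻¹ p.2 < w⁻¹ p.1

theorem card_invSet_s_mul {i : Fin (n - 1)} {w : Equiv.Perm (Fin n)}
    (h : w⁻¹ (lo i) < w⁻¹ (hi i)) : (invSet (s i * w)).card = (invSet w).card + 1 := by
  have hs : invSet (s i * w) =
      insert (lo i, hi i) ((invSet w).image fun p => (s i p.1, s i p.2)) := by
    ext ⟨a, b⟩
    simp only [invSet, Finset.mem_filter, Finset.mem_univ, true_and, s_mul_inv_apply,
      Finset.mem_insert, Finset.mem_image, Prod.mk.injEq, Prod.exists]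
    constructor
    · rintro ⟨hab, hw⟩
      by_cases e : a = lo i ∧ b = hi i
      · exact Or.inl e
      · exact Or.inr ⟨s i a, s i b, ⟨s_lt_s hab e, hw⟩, by simp, by simp⟩
    · rintro (⟨rfl, rfl⟩ | ⟨a', b', ⟨hab, hw⟩, rfl, rfl⟩)
      · exact ⟨lo_lt_hi i, by simpa using h⟩
      · refine ⟨s_lt_s hab ?_, by simpa using hw⟩
        rintro ⟨rfl, rfl⟩
        exact lt_asymm h hw
  rw [hs, Finset.card_insert_of_notMem, Finset.card_image_of_injective]
  · rintro ⟨a, b⟩ ⟨a', b'⟩ e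
    simpa using e
  · simp only [invSet, Finset.mem_image, Finset.mem_filter, Finset.mem_univ, true_and,
      Prod.mk.injEq, Prod.exists, not_exists, not_and]
    rintro a b ⟨hab, -⟩ e e'
    have ha : a = hi i := by rw [← s_s i a, e, s_lo]
    have hb : b = lo i := by rw [← s_s i b, e', s_hi]
    subst ha hb
    exact lt_asymm hab (lo_lt_hi i)

/-- At every `i`, either `s i * w` or `w` itself arises by an ascending multiplication. -/
theorem lt_or_descent (i : Fin (n - 1)) (w : Equiv.Perm (Fin n)) :
    w⁻¹ (lo i) < w⁻¹ (hi i) ∨ (s i * w)⁻¹ (lo i) < (s i * w)⁻¹ (hi i) := by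
  rw [s_mul_inv_apply, s_mul_inv_apply, s_lo, s_hi]
  exact lt_or_gt_of_ne fun e => (lo_lt_hi i).ne (w⁻¹.injective e)

@[simp] theorem wordProd_nil : wordProd ([] : List (Fin (n - 1))) = 1 := rfl

@[simp] theorem wordProd_cons (i : Fin (n - 1)) (l : List (Fin (n - 1))) :
    wordProd (i :: l) = s i * wordProd l := by simp [wordProd]

theorem card_invSet_wordProd_le (l : List (Fin (n - 1))) :
    (invSet (wordProd l)).card ≤ l.length := by
  induction l with
  | nil =>
    simp only [wordProd_nil, invSet, inv_one, Equiv.Perm.one_apply, List.length_nil,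
      Nat.le_zero, Finset.card_eq_zero, Finset.filter_eq_empty_iff]
    exact fun p _ h => lt_asymm h.1 h.2
  | cons i l ih =>
    rw [wordProd_cons, List.length_cons]
    rcases lt_or_descent i (wordProd l) with h | h
    · rw [card_invSet_s_mul h]; omega
    · have := card_invSet_s_mul h
      rw [s_mul_s_mul] at this
      omega

theorem exists_word_card_invSet (w : Equiv.Perm (Fin n)) :
    ∃ l : List (Fin (n - 1)), wordProd l = w ∧ l.length = (invSet w).card := by
  induction hN : (invSet w).card generalizing w with
  | zero =>
    refine ⟨[], ?_, rfl⟩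
    rw [wordProd_nil, eq_comm, ← inv_eq_one]
    refine eq_one_of_lt fun i => ?_
    rcases lt_or_descent i w with h | h
    · exact h
    · have := card_invSet_s_mul h
      rw [s_mul_s_mul] at this
      omega
  | succ N ih =>
    by_cases hw : ∀ i : Fin (n - 1), w⁻¹ (lo i) < w⁻¹ (hi i)
    · have h1 := eq_one_of_lt hw
      rw [inv_eq_one] at h1
      have := card_invSet_wordProd_le ([] : List (Fin (n - 1)))
      rw [wordProd_nil, ← h1, hN] at this
      exact absurd this (by simp)
    · push Not at hw
      obtain ⟨i, hi'⟩ := hw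
      have h := (lt_or_descent i w).resolve_left (not_lt.2 hi')
      have := card_invSet_s_mul h
      rw [s_mul_s_mul] at this
      obtain ⟨l, hl, hlen⟩ := ih (s i * w) (by omega)
      exact ⟨i :: l, by rw [wordProd_cons, hl, s_mul_s_mul], by rw [List.length_cons, hlen]⟩

/-- The length of a permutation is its number of inversions. -/
theorem len_eq_card_invSet (w : Equiv.Perm (Fin n)) : len w = (invSet w).card := by
  obtain ⟨l, hl, h⟩ := exists_word_card_invSet w
  refine le_antisymm (Nat.sInf_le ⟨l, hl, h⟩) ?_
  obtain ⟨l', hl', h'⟩ := exists_isReducedExpr w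
  rw [← h', ← hl']
  exact card_invSet_wordProd_le l'

theorem len_le_length (l : List (Fin (n - 1))) : len (wordProd l) ≤ l.length :=
  Nat.sInf_le ⟨l, rfl, rfl⟩

theorem len_s_mul {i : Fin (n - 1)} {w : Equiv.Perm (Fin n)} (h : w⁻¹ (lo i) < w⁻¹ (hi i)) :
    len (s i * w) = len w + 1 := by
  rw [len_eq_card_invSet, len_eq_card_invSet, card_invSet_s_mul h]

theorem len_s_mul_add_one {i : Fin (n - 1)} {w : Equiv.Perm (Fin n)}
    (h : w⁻¹ (hi i) < w⁻¹ (lo i)) : len (s i * w) + 1 = len w := by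
  have h' := (lt_or_descent i w).resolve_left (lt_asymm h)
  have := len_s_mul h'
  rw [s_mul_s_mul] at this
  exact this.symm

theorem len_inv (w : Equiv.Perm (Fin n)) : len w⁻¹ = len w := by
  have key : ∀ w : Equiv.Perm (Fin n), len w⁻¹ ≤ len w := by
    intro w
    obtain ⟨l, hl, h⟩ := exists_isReducedExpr w
    have hr : wordProd l.reverse = w⁻¹ := by
      rw [← hl, wordProd, wordProd, List.prod_inv_reverse, List.map_map, List.map_reverse]
      congr 3
    rw [← hr, ← h, ← List.length_reverse]
    exact len_le_length _
  refine le_antisymm (key w) ?_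
  simpa using key w⁻¹

/-- Induction along left multiplications by simple transpositions that increase the length. -/
theorem perm_induction {P : Equiv.Perm (Fin n) → Prop} (one : P 1)
    (step : ∀ i w, w⁻¹ (lo i) < w⁻¹ (hi i) → P w → P (s i * w)) (w : Equiv.Perm (Fin n)) : P w := by
  induction hN : len w generalizing w with
  | zero =>
    have : w = 1 := by
      obtain ⟨l, hl, h⟩ := exists_isReducedExpr w
      rw [hN, List.length_eq_zero_iff] at h
      rw [← hl, h, wordProd_nil]
    rw [this]; exact one
  | succ N ih =>
    by_cases hw : ∀ i : Fin (n - 1), w⁻¹ (lo i) < w⁻¹ (hi i)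
    · have h1 := eq_one_of_lt hw
      rw [inv_eq_one] at h1
      rw [h1]; exact one
    · push Not at hw
      obtain ⟨i, hi'⟩ := hw
      have h := (lt_or_descent i w).resolve_left (not_lt.2 hi')
      have hl := len_s_mul h
      rw [s_mul_s_mul] at hl
      have := step i _ h (ih (s i * w) (by omega))
      rwa [s_mul_s_mul] at this

/-! ### Reduced expressions and the braid relations -/

theorem IsReducedExpr.tail {i : Fin (n - 1)} {l : List (Fin (n - 1))} {w : Equiv.Perm (Fin n)}
    (h : IsReducedExpr (i :: l) w) : IsReducedExpr l (s i * w) ∧ w⁻¹ (hi i) < w⁻¹ (lo i) := by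
  obtain ⟨h1, h2⟩ := h
  rw [wordProd_cons] at h1
  rw [List.length_cons] at h2
  have hw : wordProd l = s i * w := by rw [← h1, s_mul_s_mul]
  have hle := len_le_length l
  rw [hw] at hle
  have hd : ¬ w⁻¹ (lo i) < w⁻¹ (hi i) := fun h => by
    have := len_s_mul h
    omega
  have hlt : w⁻¹ (hi i) < w⁻¹ (lo i) :=
    lt_of_le_of_ne (not_lt.1 hd) fun e => (lo_lt_hi i).ne' (w⁻¹.injective e)
  have := len_s_mul_add_one hlt
  exact ⟨⟨hw, by omega⟩, hlt⟩

theorem IsReducedExpr.cons {i : Fin (n - 1)} {l : List (Fin (n - 1))} {w : Equiv.Perm (Fin n)}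
    (h : IsReducedExpr l w) (hw : w⁻¹ (lo i) < w⁻¹ (hi i)) : IsReducedExpr (i :: l) (s i * w) := by
  refine ⟨by rw [wordProd_cons, h.1], ?_⟩
  rw [List.length_cons, h.2, len_s_mul hw]

/-- **Matsumoto's theorem** for the symmetric group: a product along a reduced expression depends
only on the permutation, as soon as the factors satisfy the braid relations. Two reduced
expressions starting with `i ≠ j` are compared through a third and a fourth one which start with
the two sides of the braid relation between `i` and `j`. -/
theorem prod_map_eq_of_isReducedExpr {M : Type*} [Monoid M] {f : Fin (n - 1) → M}
    (hc : ∀ i j : Fin (n - 1), (i : ℕ) + 1 < j → f i * f j = f j * f i)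
    (hb : ∀ i j : Fin (n - 1), (i : ℕ) + 1 = j → f i * f j * f i = f j * f i * f j)
    {w : Equiv.Perm (Fin n)} {l l' : List (Fin (n - 1))}
    (h : IsReducedExpr l w) (h' : IsReducedExpr l' w) : (l.map f).prod = (l'.map f).prod := by
  induction hN : len w using Nat.strong_induction_on generalizing w l l' with
  | _ N ih =>
  subst hN
  rcases l with _ | ⟨i, l⟩
  · have : l' = [] := by rw [← List.length_eq_zero_iff, h'.2, ← h.2]; rfl
    rw [this]
  rcases l' with _ | ⟨j, l'⟩
  · have := h.2.trans h'.2.symm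
    simp at this
  obtain ⟨hi1, hi2⟩ := h.tail
  obtain ⟨hj1, hj2⟩ := h'.tail
  have hli := len_s_mul_add_one hi2
  have hlj := len_s_mul_add_one hj2
  have far : ∀ (i j : Fin (n - 1)) (l l' : List (Fin (n - 1))), (i : ℕ) + 1 < j →
      IsReducedExpr l (s i * w) → IsReducedExpr l' (s j * w) →
      w⁻¹ (hi i) < w⁻¹ (lo i) → w⁻¹ (hi j) < w⁻¹ (lo j) →
      f i * (l.map f).prod = f j * (l'.map f).prod := by
    intro i j l l' hij hl hl' hi2 hj2
    have hli := len_s_mul_add_one hi2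
    have hlj := len_s_mul_add_one hj2
    obtain ⟨m, hm⟩ := exists_isReducedExpr (s j * (s i * w))
    have e1 := s_far (n := n) (i := i) (j := j) (Or.inl hij)
    have e2 := s_far (n := n) (i := j) (j := i) (Or.inr hij)
    have hcomm : s j * (s i * w) = s i * (s j * w) := by
      rw [← mul_assoc, ← mul_assoc, s_comm (Or.inr hij)]
    have m1 := hm.cons (i := j) (by
      simp only [s_mul_inv_apply, s_lo, s_hi, e1.1, e1.2]; exact hj2)
    have m2 := (hcomm ▸ hm).cons (i := i) (by
      simp only [s_mul_inv_apply, s_lo, s_hi, e2.1, e2.2]; exact hi2)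
    rw [s_mul_s_mul] at m1 m2
    rw [ih _ (by omega) hl m1 rfl, ih _ (by omega) hl' m2 rfl]
    simp only [List.map_cons, List.prod_cons]
    rw [← mul_assoc, hc i j hij, mul_assoc]
  have near : ∀ (i j : Fin (n - 1)) (l l' : List (Fin (n - 1))), (i : ℕ) + 1 = j →
      IsReducedExpr l (s i * w) → IsReducedExpr l' (s j * w) →
      w⁻¹ (hi i) < w⁻¹ (lo i) → w⁻¹ (hi j) < w⁻¹ (lo j) →
      f i * (l.map f).prod = f j * (l'.map f).prod := by
    intro i j l l' hij hl hl' hi2 hj2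
    have hli := len_s_mul_add_one hi2
    have hlj := len_s_mul_add_one hj2
    obtain ⟨m, hm⟩ := exists_isReducedExpr (s i * (s j * (s i * w)))
    -- the three letters involved are `lo i`, `lo j = hi i` and `hi j`
    have e := hi_eq_lo hij
    have e1 : s i (lo j) = lo i := by rw [← e, s_hi]
    have e2 := s_lo_adj hij
    have e3 := s_hi_adj hij
    rw [e] at hi2
    have hbr : s i * (s j * (s i * w)) = s j * (s i * (s j * w)) := by
      simp only [← mul_assoc, s_braid hij]
    have m1 := hm.cons (i := i) (by
      simp only [s_mul_inv_apply, s_lo, e, e1, e2, e3]; exact hj2)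
    rw [s_mul_s_mul] at m1
    replace m1 := m1.cons (i := j) (by
      simp only [s_mul_inv_apply, s_lo, s_hi, e1, e3]; exact hj2.trans hi2)
    have m2 := (hbr ▸ hm).cons (i := j) (by
      simp only [s_mul_inv_apply, s_lo, s_hi, e1, e2, e3]; exact hi2)
    rw [s_mul_s_mul] at m2
    replace m2 := m2.cons (i := i) (by
      simp only [s_mul_inv_apply, s_lo, e, e1, e2]; exact hj2.trans hi2)
    rw [s_mul_s_mul] at m1 m2
    rw [ih _ (by omega) hl m1 rfl, ih _ (by omega) hl' m2 rfl]
    simp only [List.map_cons, List.prod_cons]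
    simp only [← mul_assoc, hb i j hij]
  simp only [List.map_cons, List.prod_cons]
  rcases lt_trichotomy (i : ℕ) j with hij | hij | hij
  · rcases Nat.lt_or_ge ((i : ℕ) + 1) j with h1 | h1
    · exact far i j l l' h1 hi1 hj1 hi2 hj2
    · exact near i j l l' (by omega) hi1 hj1 hi2 hj2
  · obtain rfl := Fin.ext hij
    rw [ih _ (by omega) hi1 hj1 rfl]
  · rcases Nat.lt_or_ge ((j : ℕ) + 1) i with h1 | h1
    · exact (far j i l' l h1 hj1 hi1 hj2 hi2).symm
    · exact (near j i l' l (by omega) hj1 hi1 hj2 hi2).symm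

theorem isReducedExpr_reducedExpr (w : Equiv.Perm (Fin n)) : IsReducedExpr (reducedExpr w) w :=
  (exists_isReducedExpr w).choose_spec

theorem prod_map_reducedExpr_s_mul {M : Type*} [Monoid M] {f : Fin (n - 1) → M}
    (hc : ∀ i j : Fin (n - 1), (i : ℕ) + 1 < j → f i * f j = f j * f i)
    (hb : ∀ i j : Fin (n - 1), (i : ℕ) + 1 = j → f i * f j * f i = f j * f i * f j)
    {i : Fin (n - 1)} {w : Equiv.Perm (Fin n)} (h : w⁻¹ (lo i) < w⁻¹ (hi i)) :
    ((reducedExpr (s i * w)).map f).prod = f i * ((reducedExpr w).map f).prod := by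
  rw [prod_map_eq_of_isReducedExpr hc hb (isReducedExpr_reducedExpr (s i * w))
    ((isReducedExpr_reducedExpr w).cons h), List.map_cons, List.prod_cons]

theorem reducedExpr_one : reducedExpr (1 : Equiv.Perm (Fin n)) = [] := by
  have h := (isReducedExpr_reducedExpr (1 : Equiv.Perm (Fin n))).2
  have h1 := len_le_length ([] : List (Fin (n - 1)))
  rw [wordProd_nil, List.length_nil] at h1
  rw [← List.length_eq_zero_iff]
  omega

theorem len_one : len (1 : Equiv.Perm (Fin n)) = 0 := by
  rw [← (isReducedExpr_reducedExpr (1 : Equiv.Perm (Fin n))).2, reducedExpr_one, List.length_nil]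

end Symmetric

/-! ### The ground ring -/

instance : Nontrivial K := inferInstanceAs (Nontrivial (Polynomial (LaurentPolynomial ℂ)))

theorem u_mul_uInv : u * uInv = 1 := by
  have h : (LaurentPolynomial.T 1 * LaurentPolynomial.T (-1) : LaurentPolynomial ℂ) = 1 := by
    rw [← LaurentPolynomial.T_add, add_neg_cancel, LaurentPolynomial.T_zero]
  exact (Polynomial.C_mul.symm.trans (congrArg Polynomial.C h)).trans (map_one Polynomial.C)

theorem uInv_mul_u : uInv * u = 1 := by rw [mul_comm, u_mul_uInv]

/-- The inclusion of the complex numbers in the ground ring, as a ring homomorphism. -/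
def cstHom : ℂ →+* K :=
  (Polynomial.C : LaurentPolynomial ℂ →+* Polynomial (LaurentPolynomial ℂ)).comp
    LaurentPolynomial.C

theorem cst_eq (z : ℂ) : cst z = cstHom z := rfl

/-! ### The regular representation of the Iwahori-Hecke algebra -/

section Hecke

variable {n : ℕ}

/-- The quotient map from the free algebra to the Iwahori-Hecke algebra. -/
def heckeMk (n : ℕ) : FreeAlgebra K (Fin (n - 1)) →ₐ[K] Hecke n :=
  RingQuot.mkAlgHom K (HeckeRel n)

theorem heckeMk_ι (i : Fin (n - 1)) : heckeMk n (FreeAlgebra.ι K i) = T i := rfl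

theorem heckeMk_rel {x y : FreeAlgebra K (Fin (n - 1))} (h : HeckeRel n x y) :
    heckeMk n x = heckeMk n y :=
  RingQuot.mkAlgHom_rel K h

theorem T_comm (i j : Fin (n - 1)) (h : (i : ℕ) + 1 < j ∨ (j : ℕ) + 1 < i) :
    T i * T j = T j * T i := by
  simpa only [map_mul, heckeMk_ι] using heckeMk_rel (HeckeRel.comm i j h)

theorem T_braid (i j : Fin (n - 1)) (h : (i : ℕ) + 1 = j) :
    T i * T j * T i = T j * T i * T j := by
  simpa only [map_mul, heckeMk_ι] using heckeMk_rel (HeckeRel.braid i j h)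

theorem T_quad (i : Fin (n - 1)) : T i * T i = algebraMap K (Hecke n) (u ^ 2) + v • T i := by
  simpa only [map_mul, map_add, map_smul, AlgHom.commutes, heckeMk_ι] using
    heckeMk_rel (HeckeRel.quad i)

/-- The universal property of the Iwahori-Hecke algebra. -/
def heckeLift {A : Type*} [Semiring A] [Algebra K A] (f : Fin (n - 1) → A)
    (hc : ∀ i j : Fin (n - 1), (i : ℕ) + 1 < j → f i * f j = f j * f i)
    (hb : ∀ i j : Fin (n - 1), (i : ℕ) + 1 = j → f i * f j * f i = f j * f i * f j)
    (hq : ∀ i, f i * f i = algebraMap K A (u ^ 2) + v • f i) : Hecke n →ₐ[K] A :=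
  RingQuot.liftAlgHom K ⟨FreeAlgebra.lift K f, by
    rintro _ _ (⟨i, j, h⟩ | ⟨i, j, h⟩ | ⟨i⟩)
    · simp only [map_mul, FreeAlgebra.lift_ι_apply]
      rcases h with h | h
      · exact hc i j h
      · exact (hc j i h).symm
    · simpa only [map_mul, FreeAlgebra.lift_ι_apply] using hb i j h
    · simpa only [map_mul, map_add, map_smul, AlgHom.commutes, FreeAlgebra.lift_ι_apply]
        using hq i⟩

theorem heckeLift_T {A : Type*} [Semiring A] [Algebra K A] (f : Fin (n - 1) → A) (hc hb hq)
    (i : Fin (n - 1)) : heckeLift f hc hb hq (T i) = f i := by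
  unfold heckeLift T
  exact (RingQuot.liftAlgHom_mkAlgHom_apply K _ _ _).trans (FreeAlgebra.lift_ι_apply _ _)

theorem hecke_induction {P : Hecke n → Prop} (algebraMap : ∀ c, P (algebraMap K _ c))
    (T : ∀ i, P (T i)) (mul : ∀ x y, P x → P y → P (x * y)) (add : ∀ x y, P x → P y → P (x + y))
    (x : Hecke n) : P x := by
  obtain ⟨x, rfl⟩ := RingQuot.mkAlgHom_surjective K (HeckeRel n) x
  induction x using FreeAlgebra.induction with
  | grade0 c => rw [AlgHom.commutes]; exact algebraMap c
  | grade1 i => exact T i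
  | mul a b ha hb => rw [map_mul]; exact mul _ _ ha hb
  | add a b ha hb => rw [map_add]; exact add _ _ ha hb

theorem Tt_one : Tt (1 : Equiv.Perm (Fin n)) = 1 := by
  rw [Tt, reducedExpr_one, len_one, pow_zero, one_smul]; rfl

theorem Tt_s_mul {i : Fin (n - 1)} {w : Equiv.Perm (Fin n)} (h : w⁻¹ (lo i) < w⁻¹ (hi i)) :
    Tt (s i * w) = uInv • (T i * Tt w) := by
  rw [Tt, Tt, len_s_mul h, wordT, prod_map_reducedExpr_s_mul (fun i j h => T_comm i j (Or.inl h))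
    T_braid h, mul_smul_comm, smul_smul, ← pow_succ']
  rfl

theorem T_mul_Tt {i : Fin (n - 1)} {w : Equiv.Perm (Fin n)} (h : w⁻¹ (lo i) < w⁻¹ (hi i)) :
    T i * Tt w = u • Tt (s i * w) := by
  rw [Tt_s_mul h, smul_smul, u_mul_uInv, one_smul]

theorem T_mul_Tt_of_descent {i : Fin (n - 1)} {w : Equiv.Perm (Fin n)}
    (h : w⁻¹ (hi i) < w⁻¹ (lo i)) : T i * Tt w = u • Tt (s i * w) + v • Tt w := by
  have h' := (lt_or_descent i w).resolve_left (lt_asymm h)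
  have e := Tt_s_mul h'
  rw [s_mul_s_mul] at e
  rw [e, mul_smul_comm, ← mul_assoc, T_quad, add_mul, smul_add, smul_mul_assoc, smul_comm uInv v,
    Algebra.algebraMap_eq_smul_one, smul_mul_assoc, one_mul, smul_smul, pow_two, ← mul_assoc,
    uInv_mul_u, one_mul]

/-- The contribution `v` of a descent `y < x` to the action of a generator. -/
def descentCoeff (x y : Fin n) : K := if y < x then v else 0

/-- The operator by which `T_i` acts on the free module with basis the permutations, in which the
basis vector of `w` is going to correspond to `T̃_w`. -/
def regularOp (i : Fin (n - 1)) : Module.End K (Equiv.Perm (Fin n) →₀ K) :=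
  Finsupp.linearCombination K fun w =>
    u • Finsupp.single (s i * w) 1 + descentCoeff (w⁻¹ (lo i)) (w⁻¹ (hi i)) • Finsupp.single w 1

theorem regularOp_single (i : Fin (n - 1)) (w : Equiv.Perm (Fin n)) :
    regularOp i (Finsupp.single w 1) = u • Finsupp.single (s i * w) 1 +
      descentCoeff (w⁻¹ (lo i)) (w⁻¹ (hi i)) • Finsupp.single w 1 := by
  rw [regularOp, Finsupp.linearCombination_single, one_smul]

theorem end_ext {f g : Module.End K (Equiv.Perm (Fin n) →₀ K)}
    (h : ∀ w, f (Finsupp.single w 1) = g (Finsupp.single w 1)) : f = g :=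
  Finsupp.lhom_ext' fun w => LinearMap.ext_ring (h w)

theorem regularOp_comm (i j : Fin (n - 1)) (h : (i : ℕ) + 1 < j) :
    regularOp i * regularOp j = regularOp j * regularOp i := by
  refine end_ext fun w => ?_
  have e1 := s_far (n := n) (i := i) (j := j) (Or.inl h)
  have e2 := s_far (n := n) (i := j) (j := i) (Or.inr h)
  have hc : s j * (s i * w) = s i * (s j * w) := by
    rw [← mul_assoc, ← mul_assoc, s_comm (Or.inr h)]
  simp only [Module.End.mul_apply, regularOp_single, map_add, map_smul, s_mul_inv_apply, e1, e2, hc]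
  module

theorem regularOp_braid (i j : Fin (n - 1)) (h : (i : ℕ) + 1 = j) :
    regularOp i * regularOp j * regularOp i = regularOp j * regularOp i * regularOp j := by
  refine end_ext fun w => ?_
  have e := hi_eq_lo h
  have e1 : s i (lo j) = lo i := by rw [← e, s_hi]
  have e2 := s_lo_adj h
  have e3 := s_hi_adj h
  have hbr : s j * (s i * (s j * w)) = s i * (s j * (s i * w)) := by
    simp only [← mul_assoc, s_braid h]
  simp only [Module.End.mul_apply, regularOp_single, map_add, map_smul, s_mul_inv_apply, s_lo, s_hi,
    e, e1, e2, e3, hbr, s_mul_s_mul]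
  have h1 : w⁻¹ (lo i) ≠ w⁻¹ (lo j) := by
    rw [← e]; exact w⁻¹.injective.ne (lo_lt_hi i).ne
  have h2 : w⁻¹ (lo j) ≠ w⁻¹ (hi j) := w⁻¹.injective.ne (lo_lt_hi j).ne
  have h3 : w⁻¹ (lo i) ≠ w⁻¹ (hi j) := by
    refine w⁻¹.injective.ne (lt_trans (b := lo j) ?_ (lo_lt_hi j)).ne
    rw [← e]; exact lo_lt_hi i
  generalize w⁻¹ (lo i) = a at h1 h2 h3 ⊢
  generalize w⁻¹ (lo j) = b at h1 h2 h3 ⊢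
  generalize w⁻¹ (hi j) = c at h1 h2 h3 ⊢
  simp only [descentCoeff]
  rcases lt_or_gt_of_ne h1 with h1 | h1 <;> rcases lt_or_gt_of_ne h2 with h2 | h2 <;>
    rcases lt_or_gt_of_ne h3 with h3 | h3 <;>
    first
    | omega
    | (simp only [h1, h2, h3, h1.not_gt, h2.not_gt, h3.not_gt, if_true, if_false]; module)

theorem regularOp_quad (i : Fin (n - 1)) :
    regularOp i * regularOp i =
      algebraMap K (Module.End K (Equiv.Perm (Fin n) →₀ K)) (u ^ 2) + v • regularOp i := by
  refine end_ext fun w => ?_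
  simp only [Module.End.mul_apply, LinearMap.add_apply, LinearMap.smul_apply,
    Module.algebraMap_end_apply, regularOp_single, map_add, map_smul, s_mul_inv_apply, s_lo, s_hi,
    s_mul_s_mul]
  have h1 : w⁻¹ (lo i) ≠ w⁻¹ (hi i) := fun h => (lo_lt_hi i).ne (w⁻¹.injective h)
  simp only [descentCoeff]
  rcases lt_or_gt_of_ne h1 with h1 | h1 <;>
    (simp only [h1, h1.not_gt, if_true, if_false]; module)

/-- The regular representation of the Iwahori-Hecke algebra. -/
def regularRep : Hecke n →ₐ[K] Module.End K (Equiv.Perm (Fin n) →₀ K) :=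
  heckeLift regularOp regularOp_comm regularOp_braid regularOp_quad

theorem regularRep_Tt (w : Equiv.Perm (Fin n)) :
    regularRep (Tt w) (Finsupp.single 1 1) = Finsupp.single w 1 := by
  induction w using perm_induction with
  | one => rw [Tt_one, map_one, Module.End.one_apply]
  | step i w h ih =>
    rw [Tt_s_mul h, map_smul, map_mul, LinearMap.smul_apply, Module.End.mul_apply, ih, regularRep,
      heckeLift_T, regularOp_single, descentCoeff, if_neg (lt_asymm h), zero_smul, add_zero,
      smul_smul, uInv_mul_u, one_smul]

theorem linearIndependent_Tt :
    LinearIndependent K (Tt : Equiv.Perm (Fin n) → Hecke n) := by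
  refine LinearIndependent.of_comp
    ((LinearMap.applyₗ (Finsupp.single 1 1)).comp regularRep.toLinearMap) ?_
  convert (Finsupp.basisSingleOne (R := K) (ι := Equiv.Perm (Fin n))).linearIndependent using 1
  funext w
  simpa using regularRep_Tt w

/-- The span of the `T̃_w`, for `w` in a set stable under left multiplication by `s i`, is stable
under left multiplication by `T i`. -/
theorem T_mul_mem_span {P : Set (Equiv.Perm (Fin n))} {i : Fin (n - 1)}
    (hP : ∀ w ∈ P, s i * w ∈ P) {x : Hecke n} (hx : x ∈ Submodule.span K (Tt '' P)) :
    T i * x ∈ Submodule.span K (Tt '' P) := by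
  have hT : ∀ w ∈ P, Tt w ∈ Submodule.span K (Tt '' P) := fun w hw =>
    Submodule.subset_span (Set.mem_image_of_mem Tt hw)
  induction hx using Submodule.span_induction with
  | mem x hx =>
    obtain ⟨w, hw, rfl⟩ := hx
    have hsw := Submodule.smul_mem _ u (hT _ (hP w hw))
    rcases lt_or_gt_of_ne fun e => (lo_lt_hi i).ne (w⁻¹.injective e) with h | h
    · rwa [T_mul_Tt h]
    · rw [T_mul_Tt_of_descent h]
      exact Submodule.add_mem _ hsw (Submodule.smul_mem _ v (hT _ hw))
  | zero => rw [mul_zero]; exact Submodule.zero_mem _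
  | add a b _ _ ha hb => rw [mul_add]; exact Submodule.add_mem _ ha hb
  | smul c a _ ha => rw [mul_smul_comm]; exact Submodule.smul_mem _ _ ha

theorem span_Tt : ⊤ ≤ Submodule.span K (Set.range (Tt : Equiv.Perm (Fin n) → Hecke n)) := by
  have key : ∀ x : Hecke n, ∀ y ∈ Submodule.span K (Tt '' (Set.univ : Set (Equiv.Perm (Fin n)))),
      x * y ∈ Submodule.span K (Tt '' (Set.univ : Set (Equiv.Perm (Fin n)))) := by
    intro x
    induction x using hecke_induction with
    | algebraMap c => intro y hy; rw [← Algebra.smul_def]; exact Submodule.smul_mem _ _ hy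
    | T i => exact fun y hy => T_mul_mem_span (fun _ _ => Set.mem_univ _) hy
    | add a b ha hb => intro y hy; rw [add_mul]; exact Submodule.add_mem _ (ha y hy) (hb y hy)
    | mul a b ha hb => intro y hy; rw [mul_assoc]; exact ha _ (hb y hy)
  intro x _
  have := key x 1 (Tt_one (n := n) ▸ Submodule.subset_span (Set.mem_image_of_mem Tt trivial))
  rwa [mul_one, Set.image_univ] at this

/-- The basis of the Iwahori-Hecke algebra formed by the `T̃_w`. -/
def heckeBasis (n : ℕ) : Module.Basis (Equiv.Perm (Fin n)) K (Hecke n) :=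
  Module.Basis.mk linearIndependent_Tt span_Tt

end Hecke

/-! ### The basis of the algebra of a Young subgroup -/

section Young

variable {d n : ℕ} (μ : Comp d n)

theorem block_blockEquiv (a : Fin d) (j : Fin (μ.1 a)) : block μ (blockEquiv μ ⟨a, j⟩) = a := by
  rw [block, Equiv.symm_apply_apply]

theorem blockEquiv_val (a : Fin d) (j : Fin (μ.1 a)) :
    (blockEquiv μ ⟨a, j⟩ : ℕ) = ∑ b ∈ Finset.Iio a, μ.1 b + j := by
  have h : (blockEquiv μ ⟨a, j⟩ : ℕ) = (finSigmaFinEquiv ⟨a, j⟩ : ℕ) := rfl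
  rw [h, finSigmaFinEquiv_apply]
  congr 1
  refine Finset.sum_bij (fun i _ => Fin.castLE a.2.le i) ?_ ?_ ?_ ?_
  · exact fun i _ => Finset.mem_Iio.2 i.2
  · exact fun i _ i' _ e => Fin.castLE_injective _ e
  · exact fun b hb => ⟨⟨b, Fin.lt_def.1 (Finset.mem_Iio.1 hb)⟩, Finset.mem_univ _, rfl⟩
  · exact fun i _ => rfl

/-- The blocks of smaller index end where a block begins, or before. -/
theorem sum_Iio_add_le {a b : Fin d} (h : a < b) :
    ∑ c ∈ Finset.Iio a, μ.1 c + μ.1 a ≤ ∑ c ∈ Finset.Iio b, μ.1 c := by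
  have hsub : insert a (Finset.Iio a) ⊆ Finset.Iio b := by
    intro c hc
    rw [Finset.mem_Iio]
    rcases Finset.mem_insert.1 hc with rfl | hc
    · exact h
    · exact (Finset.mem_Iio.1 hc).trans h
  have hle := Finset.sum_le_sum_of_subset (f := μ.1) hsub
  rw [Finset.sum_insert (by simp)] at hle
  omega

theorem block_mono {x y : Fin n} (h : x ≤ y) : block μ x ≤ block μ y := by
  obtain ⟨⟨a, j⟩, rfl⟩ := (blockEquiv μ).surjective x
  obtain ⟨⟨b, k⟩, rfl⟩ := (blockEquiv μ).surjective y
  rw [block_blockEquiv, block_blockEquiv]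
  by_contra hab
  have hle := sum_Iio_add_le μ (not_le.1 hab)
  rw [Fin.le_def, blockEquiv_val, blockEquiv_val] at h
  have := k.2
  omega

theorem mem_I {i : Fin (n - 1)} : i ∈ I μ ↔ block μ (lo i) = block μ (hi i) := Iff.rfl

theorem swap_mem_young {x y : Fin n} (h : block μ x = block μ y) : Equiv.swap x y ∈ young μ := by
  intro z
  by_cases h1 : z = x
  · rw [h1, Equiv.swap_apply_left, h]
  by_cases h2 : z = y
  · rw [h2, Equiv.swap_apply_right, h]
  rw [Equiv.swap_apply_of_ne_of_ne h1 h2]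

theorem s_mem_young {i : Fin (n - 1)} (h : i ∈ I μ) : s i ∈ young μ :=
  swap_mem_young μ h

theorem mem_young_iff {w : Equiv.Perm (Fin n)} :
    w ∈ young μ ↔ ∀ x, block μ (w x) = block μ x := Iff.rfl

theorem lt_of_block_lt {x y : Fin n} (h : block μ x < block μ y) : x < y :=
  lt_of_not_ge fun h' => (block_mono μ h').not_gt h

/-- The descents of an element of the Young subgroup lie inside the blocks. -/
theorem lt_of_notMem_I {i : Fin (n - 1)} {w : Equiv.Perm (Fin n)} (hw : w ∈ young μ)
    (h : i ∉ I μ) : w (lo i) < w (hi i) := by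
  refine lt_of_block_lt μ ?_
  rw [hw, hw]
  exact lt_of_le_of_ne (block_mono μ (lo_lt_hi i).le) h

theorem Tt_mem_Hmu {w : Equiv.Perm (Fin n)} (hw : w ∈ young μ) : Tt w ∈ Hmu μ := by
  induction w using perm_induction with
  | one => rw [Tt_one]; exact one_mem _
  | step i w h ih =>
    have hI : i ∈ I μ := by
      by_contra hI
      have := lt_of_notMem_I μ (inv_mem hw) hI
      rw [s_mul_inv_apply, s_mul_inv_apply, s_lo, s_hi] at this
      exact lt_asymm h this
    rw [Tt_s_mul h]
    refine Subalgebra.smul_mem _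
      (mul_mem (Algebra.subset_adjoin (Set.mem_image_of_mem T hI)) (ih ?_)) _
    have := mul_mem (s_mem_young μ hI) hw
    rwa [s_mul_s_mul] at this

/-- The element `T̃_w` of `H^μ`, for `w` in the Young subgroup. -/
def TtYoung (w : young μ) : Hmu μ := ⟨Tt (w : Equiv.Perm (Fin n)), Tt_mem_Hmu μ w.2⟩

theorem linearIndependent_TtYoung : LinearIndependent K (TtYoung μ) :=
  LinearIndependent.of_comp (Hmu μ).val.toLinearMap
    (linearIndependent_Tt.comp (fun w : young μ => (w : Equiv.Perm (Fin n)))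
      Subtype.val_injective)

theorem Hmu_le_span : (Hmu μ).toSubmodule ≤ Submodule.span K (Tt '' (young μ : Set _)) := by
  have key : ∀ x ∈ Hmu μ, ∀ y ∈ Submodule.span K (Tt '' (young μ : Set (Equiv.Perm (Fin n)))),
      x * y ∈ Submodule.span K (Tt '' (young μ : Set (Equiv.Perm (Fin n)))) := by
    intro x hx
    induction hx using Algebra.adjoin_induction with
    | mem x hx =>
      obtain ⟨i, hi', rfl⟩ := hx
      exact fun y hy => T_mul_mem_span (fun w hw => mul_mem (s_mem_young μ hi') hw) hy
    | algebraMap c => intro y hy; rw [← Algebra.smul_def]; exact Submodule.smul_mem _ _ hy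
    | add a b _ _ ha hb => intro y hy; rw [add_mul]; exact Submodule.add_mem _ (ha y hy) (hb y hy)
    | mul a b _ _ ha hb => intro y hy; rw [mul_assoc]; exact ha _ (hb y hy)
  intro x hx
  have := key x hx 1
    (Tt_one (n := n) ▸ Submodule.subset_span (Set.mem_image_of_mem Tt (one_mem (young μ))))
  rwa [mul_one] at this

theorem span_TtYoung : ⊤ ≤ Submodule.span K (Set.range (TtYoung μ)) := by
  rintro ⟨x, hx⟩ -
  have h := Hmu_le_span μ hx
  have hr : Tt '' (young μ : Set (Equiv.Perm (Fin n))) =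
      (Hmu μ).val.toLinearMap '' Set.range (TtYoung μ) := by
    rw [← Set.range_comp, Set.image_eq_range]; rfl
  rw [hr, Submodule.span_image] at h
  obtain ⟨y, hy, e⟩ := h
  rwa [show (⟨x, hx⟩ : Hmu μ) = y from Subtype.ext e.symm]

/-- The basis of `H^μ` formed by the `T̃_w`, for `w` in the Young subgroup. -/
def youngBasis : Module.Basis (young μ) K (Hmu μ) :=
  Module.Basis.mk (linearIndependent_TtYoung μ) (span_TtYoung μ)

theorem youngBasis_apply (w : young μ) : youngBasis μ w = TtYoung μ w :=
  Module.Basis.mk_apply _ _ _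

/-! ### The number of elements of a Young subgroup -/

instance : DecidablePred (· ∈ young μ) := fun w =>
  inferInstanceAs (Decidable (∀ x, block μ (w x) = block μ x))

theorem card_block (a : Fin d) : Fintype.card {x : Fin n // block μ x = a} = μ.1 a := by
  have e : {x : Fin n // block μ x = a} ≃ Fin (μ.1 a) :=
    ((blockEquiv μ).symm.subtypeEquiv fun _ => Iff.rfl).trans (Equiv.sigmaSubtype a)
  rw [Fintype.card_congr e, Fintype.card_fin]

theorem card_young : Fintype.card (young μ) = ∏ a, (μ.1 a)! := by
  have e : young μ ≃ {g : Equiv.Perm (Fin n) // block μ ∘ g = block μ} :=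
    (Equiv.refl _).subtypeEquiv fun w => funext_iff.symm
  rw [Fintype.card_congr e, DomMulAct.stabilizer_card]
  exact Finset.prod_congr rfl fun a _ => by rw [card_block]

end Young

/-! ### The algebra of a Young subgroup as a tensor product -/

section Tensor

/-- Algebra homomorphisms with pairwise commuting images assemble to a homomorphism on the tensor
product. -/
def tensorLift {R ι S : Type*} [CommSemiring R] [Fintype ι] [DecidableEq ι] {A : ι → Type*}
    [∀ i, Semiring (A i)] [∀ i, Algebra R (A i)] [Semiring S] [Algebra R S]
    (F : ∀ i, A i →ₐ[R] S) (hF : Pairwise fun i j => ∀ x y, Commute (F i x) (F j y)) :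
    (⨂[R] i, A i) →ₐ[R] S :=
  let P : (∀ i, A i) →* S := MonoidHom.noncommPiCoprod (fun i => (F i : A i →* S)) hF
  have hP : ∀ (x : ∀ i, A i) (i : ι) (y : A i),
      P (Function.update x i y) = P (Function.update x i 1) * F i y := by
    intro x i y
    have h : Function.update x i y = Function.update x i 1 * Pi.mulSingle i y := by
      ext j
      by_cases hj : j = i
      · subst hj; simp
      · simp [hj]
    rw [h, map_mul]
    congr 1
    exact MonoidHom.noncommPiCoprod_mulSingle _ i y
  PiTensorProduct.liftAlgHom
    (MultilinearMap.mk' P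
      (fun x i y z => by rw [hP, hP x i y, hP x i z, map_add, mul_add])
      (fun x i c y => by rw [hP, hP x i y, map_smul, mul_smul_comm]))
    (map_one P) (map_mul P)

theorem tensorLift_mulSingle {R ι S : Type*} [CommSemiring R] [Fintype ι] [DecidableEq ι]
    {A : ι → Type*} [∀ i, Semiring (A i)] [∀ i, Algebra R (A i)] [Semiring S] [Algebra R S]
    (F : ∀ i, A i →ₐ[R] S) (hF : Pairwise fun i j => ∀ x y, Commute (F i x) (F j y))
    (i : ι) (x : A i) :
    tensorLift F hF (PiTensorProduct.tprod R (Pi.mulSingle i x)) = F i x := by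
  refine (PiTensorProduct.lift.tprod _).trans ?_
  exact MonoidHom.noncommPiCoprod_mulSingle (fun i => (F i : A i →* S)) (hcomm := hF) i x

variable {d n : ℕ} (μ : Comp d n)

/-- The index in `Fin (n - 1)` of the `i`-th simple transposition of the `a`-th block. -/
def blockIndex (a : Fin d) (i : Fin (μ.1 a - 1)) : Fin (n - 1) :=
  ⟨∑ b ∈ Finset.Iio a, μ.1 b + i, by
    have h := (blockEquiv μ ⟨a, hi i⟩).2
    rw [blockEquiv_val, hi_val] at h
    omega⟩

theorem lo_blockIndex (a : Fin d) (i : Fin (μ.1 a - 1)) :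
    lo (blockIndex μ a i) = blockEquiv μ ⟨a, lo i⟩ :=
  Fin.ext (blockEquiv_val μ a (lo i)).symm

theorem hi_blockIndex (a : Fin d) (i : Fin (μ.1 a - 1)) :
    hi (blockIndex μ a i) = blockEquiv μ ⟨a, hi i⟩ :=
  Fin.ext (blockEquiv_val μ a (hi i)).symm

theorem blockIndex_mem_I (a : Fin d) (i : Fin (μ.1 a - 1)) : blockIndex μ a i ∈ I μ := by
  rw [mem_I, lo_blockIndex, hi_blockIndex, block_blockEquiv, block_blockEquiv]

/-- Each element of `I μ` comes from a block. -/
theorem exists_blockIndex {i : Fin (n - 1)} (h : i ∈ I μ) : ∃ a j, blockIndex μ a j = i := by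
  rw [mem_I] at h
  obtain ⟨⟨a, j⟩, hj⟩ := (blockEquiv μ).surjective (lo i)
  obtain ⟨⟨b, k⟩, hk⟩ := (blockEquiv μ).surjective (hi i)
  rw [← hj, ← hk, block_blockEquiv, block_blockEquiv] at h
  subst h
  have h1 := congrArg Fin.val hj
  have h2 := congrArg Fin.val hk
  rw [blockEquiv_val] at h1 h2
  rw [lo_val] at h1
  rw [hi_val] at h2
  have := k.2
  exact ⟨a, ⟨j, by omega⟩, Fin.ext h1⟩

theorem blockIndex_add_one_lt {a b : Fin d} (h : a < b) (i : Fin (μ.1 a - 1))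
    (j : Fin (μ.1 b - 1)) : (blockIndex μ a i : ℕ) + 1 < blockIndex μ b j := by
  have := sum_Iio_add_le μ h
  simp only [blockIndex]
  omega

/-- The generator of `H^μ` with index `i ∈ I μ`. -/
def Tmu (i : Fin (n - 1)) (h : i ∈ I μ) : Hmu μ :=
  ⟨T i, Algebra.subset_adjoin (Set.mem_image_of_mem T h)⟩

/-- The embedding of the Hecke algebra of a block in `H^μ`. -/
def blockHom (a : Fin d) : Hecke (μ.1 a) →ₐ[K] Hmu μ :=
  heckeLift (fun i => Tmu μ _ (blockIndex_mem_I μ a i))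
    (fun i j h => Subtype.ext (T_comm _ _ (Or.inl (by simp only [blockIndex]; omega))))
    (fun i j h => Subtype.ext (T_braid _ _ (by simp only [blockIndex]; omega)))
    (fun i => Subtype.ext (T_quad _))

theorem blockHom_T (a : Fin d) (i : Fin (μ.1 a - 1)) :
    blockHom μ a (T i) = Tmu μ _ (blockIndex_mem_I μ a i) :=
  heckeLift_T _ _ _ _ i

theorem commute_blockHom :
    Pairwise fun a b => ∀ x y, Commute (blockHom μ a x) (blockHom μ b y) := by
  intro a b hab x y
  induction x using hecke_induction with
  | algebraMap c => rw [AlgHom.commutes]; exact Algebra.commute_algebraMap_left _ _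
  | mul x y hx hy => rw [map_mul]; exact hx.mul_left hy
  | add x y hx hy => rw [map_add]; exact hx.add_left hy
  | T i =>
    induction y using hecke_induction with
    | algebraMap c => rw [AlgHom.commutes]; exact Algebra.commute_algebraMap_right _ _
    | mul x y hx hy => rw [map_mul]; exact hx.mul_right hy
    | add x y hx hy => rw [map_add]; exact hx.add_right hy
    | T j =>
      rw [blockHom_T, blockHom_T]
      refine Subtype.ext (T_comm _ _ ?_)
      rcases lt_or_gt_of_ne hab with h | h
      · exact Or.inl (blockIndex_add_one_lt μ h i j)
      · exact Or.inr (blockIndex_add_one_lt μ h j i)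

/-- The multiplication map from the tensor product of the Hecke algebras of the blocks. -/
def tensorHom : (⨂[K] a, Hecke (μ.1 a)) →ₐ[K] Hmu μ := tensorLift (blockHom μ) (commute_blockHom μ)

theorem tensorHom_mulSingle (a : Fin d) (i : Fin (μ.1 a - 1)) :
    tensorHom μ (PiTensorProduct.tprod K (Pi.mulSingle a (T i))) =
      Tmu μ _ (blockIndex_mem_I μ a i) :=
  (tensorLift_mulSingle (blockHom μ) (commute_blockHom μ) a (T i)).trans (blockHom_T μ a i)

theorem tensorHom_surjective : Function.Surjective (tensorHom μ) := by
  have h : Hmu μ ≤ ((Hmu μ).val.comp (tensorHom μ)).range := by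
    refine Algebra.adjoin_le ?_
    rintro _ ⟨i, hi', rfl⟩
    obtain ⟨a, j, rfl⟩ := exists_blockIndex μ hi'
    exact (AlgHom.mem_range _).2 ⟨PiTensorProduct.tprod K (Pi.mulSingle a (T j)),
      congrArg Subtype.val (tensorHom_mulSingle μ a j)⟩
  intro x
  obtain ⟨y, hy⟩ := h x.2
  exact ⟨y, Subtype.ext hy⟩

/-- Both sides are free of the same finite rank, so that a surjection is an isomorphism. -/
theorem tensorHom_bijective : Function.Bijective (tensorHom μ) := by
  refine ⟨?_, tensorHom_surjective μ⟩
  let b := Basis.piTensorProduct fun a => heckeBasis (μ.1 a)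
  have hcard : Fintype.card (∀ a, Equiv.Perm (Fin (μ.1 a))) = Fintype.card (young μ) := by
    rw [card_young, Fintype.card_pi]
    exact Finset.prod_congr rfl fun a _ => by rw [Fintype.card_perm, Fintype.card_fin]
  let e : (⨂[K] a, Hecke (μ.1 a)) ≃ₗ[K] Hmu μ :=
    b.equiv (youngBasis μ) (Fintype.equivOfCardEq hcard)
  have : Module.Finite K (⨂[K] a, Hecke (μ.1 a)) := Module.Finite.of_basis b
  have h := OrzechProperty.injective_of_surjective_endomorphism
    (e.symm.toLinearMap ∘ₗ (tensorHom μ).toLinearMap)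
    (e.symm.surjective.comp (tensorHom_surjective μ))
  rw [LinearMap.coe_comp] at h
  exact Function.Injective.of_comp h

end Tensor

/-! ### Spectral projections of commuting roots of unity -/

section Projections

variable {d n : ℕ} {A : Type*} [Ring A] [Algebra K A]

/-- The orthogonality relation for roots of unity, in the form in which it enters the products of
the idempotents `E_χ`. -/
theorem inv_mul_sum_pow_mul_pow [NeZero d] {z ω : ℂ} (hz : z ^ d = 1) (hω : ω ^ d = 1) :
    (d : ℂ)⁻¹ * ∑ r ∈ Finset.range d, z ^ r * ω ^ (d - r) = if z = ω then 1 else 0 := by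
  have hd : (d : ℂ) ≠ 0 := NeZero.ne _
  have hω0 : ω ≠ 0 := by
    rintro rfl
    rw [zero_pow (NeZero.ne d)] at hω
    exact zero_ne_one hω
  have h : ∀ r ∈ Finset.range d, z ^ r * ω ^ (d - r) = (z / ω) ^ r := by
    intro r hr
    rw [pow_sub₀ _ hω0 (Finset.mem_range.1 hr).le, hω, one_mul, div_pow, div_eq_mul_inv]
  rw [Finset.sum_congr rfl h]
  split_ifs with e
  · rw [e, div_self hω0]
    simp [hd]
  · have h1 : z / ω ≠ 1 := fun h' => e ((div_eq_one_iff_eq hω0).1 h')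
    rw [geom_sum_eq h1, div_pow, hz, hω, div_one, sub_self, zero_div, mul_zero]

theorem cst_inv_smul_sum_eq [NeZero d] {z ω : ℂ} (hz : z ^ d = 1) (hω : ω ^ d = 1) (y : A) :
    cst (d : ℂ)⁻¹ • ∑ r ∈ Finset.range d, cst (z ^ r * ω ^ (d - r)) • y =
      if z = ω then y else 0 := by
  have := congrArg cstHom (inv_mul_sum_pow_mul_pow hz hω)
  rw [map_mul, map_sum] at this
  rw [← Finset.sum_smul, smul_smul]
  simp only [cst_eq]
  rw [this]
  split_ifs <;> simp

/-- The element `(1/d) ∑_{0 ≤ r < d} z^r x^{d-r}`: when `x ^ d = 1`, the projection to the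
eigenspace of `x` for the `d`-th root of unity `z`. -/
def proj (d : ℕ) (z : ℂ) (x : A) : A :=
  cst (d : ℂ)⁻¹ • ∑ r ∈ Finset.range d, cst (z ^ r) • x ^ (d - r)

theorem pow_mul_of_eigen {c : K} {x y : A} (h : x * y = c • y) (k : ℕ) :
    x ^ k * y = c ^ k • y := by
  induction k with
  | zero => simp
  | succ k ih => rw [pow_succ, mul_assoc, h, mul_smul_comm, ih, smul_smul, ← pow_succ']

theorem proj_mul_of_eigen [NeZero d] {z ω : ℂ} (hz : z ^ d = 1) (hω : ω ^ d = 1) {x y : A}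
    (h : x * y = cst ω • y) : proj d z x * y = if z = ω then y else 0 := by
  have e : ∀ r, (cst (z ^ r) • x ^ (d - r)) * y = cst (z ^ r * ω ^ (d - r)) • y := by
    intro r
    rw [smul_mul_assoc, pow_mul_of_eigen h, smul_smul, cst_eq, cst_eq, cst_eq, map_mul,
      map_pow cstHom ω]
  rw [proj, smul_mul_assoc, Finset.sum_mul, Finset.sum_congr rfl fun r _ => e r,
    cst_inv_smul_sum_eq hz hω]

theorem mul_proj [NeZero d] {z : ℂ} (hz : z ^ d = 1) {x : A} (hx : x ^ d = 1) :
    x * proj d z x = cst z • proj d z x := by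
  obtain ⟨k, rfl⟩ := Nat.exists_eq_succ_of_ne_zero (NeZero.ne d)
  rw [proj, mul_smul_comm, smul_comm (cst z)]
  congr 1
  conv_lhs => rw [Finset.sum_range_succ']
  conv_rhs => rw [Finset.sum_range_succ]
  rw [mul_add, smul_add, Finset.mul_sum, Finset.smul_sum]
  congr 1
  · refine Finset.sum_congr rfl fun r hr => ?_
    have hr := Finset.mem_range.1 hr
    rw [mul_smul_comm, ← pow_succ', smul_smul, cst_eq, cst_eq, cst_eq, ← map_mul, ← pow_succ',
      show k.succ - (r + 1) + 1 = k.succ - r by omega]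
  · rw [Nat.sub_zero, hx, smul_smul, cst_eq, cst_eq, cst_eq, ← map_mul, ← pow_succ', hz,
      show k.succ - k = 1 by omega]
    simp

theorem commute_proj {x y : A} (h : Commute x y) (z : ℂ) : Commute x (proj d z y) :=
  (Commute.sum_right _ _ _ fun _ _ => (h.pow_right _).smul_right _).smul_right _

theorem sum_proj [NeZero d] [Fintype (rootsOfUnity d ℂ)] {x : A} (hx : x ^ d = 1) :
    ∑ z : rootsOfUnity d ℂ, proj d ((z : ℂˣ) : ℂ) x = 1 := by
  have hd : (d : ℂ) ≠ 0 := NeZero.ne _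
  have hsum : ∀ r ∈ Finset.range d, ∑ z : rootsOfUnity d ℂ, ((z : ℂˣ) : ℂ) ^ r =
      if r = 0 then (d : ℂ) else 0 := by
    intro r hr
    split_ifs with h0
    · simp only [h0, pow_zero, Finset.sum_const, Finset.card_univ, nsmul_one,
        ← Nat.card_eq_fintype_card, Complex.card_rootsOfUnity]
    · let f : rootsOfUnity d ℂ →* ℂ :=
        ((powMonoidHom r).comp (Units.coeHom ℂ)).comp (rootsOfUnity d ℂ).subtype
      have hf : f ≠ 1 := by
        intro hf
        have hp := Complex.isPrimitiveRoot_exp d (NeZero.ne d)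
        have h1 := DFunLike.congr_fun hf hp.toRootsOfUnity
        have h2 : Complex.exp (2 * Real.pi * Complex.I / d) ^ r = 1 := h1
        have := Nat.le_of_dvd (Nat.pos_of_ne_zero h0) (hp.dvd_of_pow_eq_one _ h2)
        have := Finset.mem_range.1 hr
        omega
      exact sum_hom_units_eq_zero f hf
  simp only [proj]
  rw [← Finset.smul_sum, Finset.sum_comm]
  have e : ∀ r ∈ Finset.range d, ∑ z : rootsOfUnity d ℂ, cst (((z : ℂˣ) : ℂ) ^ r) • x ^ (d - r) =
      if r = 0 then cst (d : ℂ) • (1 : A) else 0 := by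
    intro r hr
    rw [← Finset.sum_smul]
    simp only [cst_eq]
    rw [← map_sum, hsum r hr]
    split_ifs with h0
    · rw [h0, Nat.sub_zero, hx]
    · simp
  rw [Finset.sum_congr rfl e, Finset.sum_ite_eq' (Finset.range d) 0 fun _ => cst (d : ℂ) • (1 : A),
    if_pos (Finset.mem_range.2 (NeZero.pos d)), smul_smul, cst_eq, cst_eq, ← map_mul,
    inv_mul_cancel₀ hd, map_one, one_smul]

theorem val_pow (χ : Chr d n) (i : Fin n) : val χ i ^ d = 1 := by
  have h := (mem_rootsOfUnity d (χ i : ℂˣ)).1 (χ i).2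
  rw [val, ← Units.val_pow_eq_pow_val, h, Units.val_one]

theorem val_inj {χ ψ : Chr d n} {i j : Fin n} : val χ i = val ψ j ↔ χ i = ψ j := by
  rw [val, val, Units.val_inj, Subtype.val_inj]

open scoped Classical in
theorem list_prod_mul_of_eigen {ι A : Type*} [Ring A] (p : ι → Prop) (f : ι → A) {y : A}
    (h : ∀ i, f i * y = if p i then y else 0) (l : List ι) :
    (l.map f).prod * y = if ∀ i ∈ l, p i then y else 0 := by
  induction l with
  | nil => simp
  | cons i l ih =>
    rw [List.map_cons, List.prod_cons, mul_assoc, ih]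
    by_cases hl : ∀ j ∈ l, p j
    · rw [if_pos hl, h]
      simp only [List.forall_mem_cons, and_iff_left hl]
    · rw [if_neg hl, mul_zero, if_neg fun hl' => hl fun j hj => hl' j (List.mem_cons_of_mem _ hj)]

/-- The product over `i` of the projections to the eigenspaces of `x i` for `χ i`. -/
def charProj (χ : Chr d n) (x : Fin n → A) : A :=
  (List.ofFn fun i => proj d (val χ i) (x i)).prod

open scoped Classical in
theorem charProj_mul_of_eigen [NeZero d] (χ ω : Chr d n) {x : Fin n → A} {y : A}
    (h : ∀ i, x i * y = cst (val ω i) • y) : charProj χ x * y = if χ = ω then y else 0 := by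
  rw [charProj, List.ofFn_eq_map, list_prod_mul_of_eigen (fun i => val χ i = val ω i)
    (fun i => proj d (val χ i) (x i))
    fun i => proj_mul_of_eigen (val_pow χ i) (val_pow ω i) (h i)]
  simp only [List.mem_finRange, true_imp_iff, val_inj, funext_iff]

theorem map_charProj {B : Type*} [Ring B] [Algebra K B] (F : A →ₐ[K] B) (χ : Chr d n)
    (x : Fin n → A) : F (charProj χ x) = charProj χ (F ∘ x) := by
  rw [charProj, charProj, map_list_prod, List.map_ofFn]
  congr 2
  funext i
  simp [proj]

theorem commute_charProj {x : Fin n → A} {y : A} (h : ∀ i, Commute y (x i)) (χ : Chr d n) :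
    Commute y (charProj χ x) := by
  refine Commute.list_prod_right _ _ fun z hz => ?_
  obtain ⟨i, rfl⟩ := (List.mem_ofFn' _ _).1 hz
  exact commute_proj (h i) _

theorem mul_list_prod_of_eigen {ι : Type*} (f : ι → A) {x : A} {c : K} {j : ι}
    (hj : x * f j = c • f j) (hx : ∀ i, Commute x (f i)) {l : List ι} (hl : j ∈ l) :
    x * (l.map f).prod = c • (l.map f).prod := by
  induction l with
  | nil => simp at hl
  | cons i l ih =>
    rw [List.map_cons, List.prod_cons]
    rcases List.mem_cons.1 hl with rfl | hl
    · rw [← mul_assoc, hj, smul_mul_assoc]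
    · rw [← mul_assoc, (hx i).eq, mul_assoc, ih hl, mul_smul_comm]

theorem mul_charProj [NeZero d] {x : Fin n → A} (hx : ∀ i j, Commute (x i) (x j))
    (hd : ∀ i, x i ^ d = 1) (χ : Chr d n) (i : Fin n) :
    x i * charProj χ x = cst (val χ i) • charProj χ x := by
  rw [charProj, List.ofFn_eq_map]
  exact mul_list_prod_of_eigen (fun i => proj d (val χ i) (x i)) (j := i)
    (mul_proj (val_pow χ i) (hd i)) (fun j => commute_proj (hx i j) _) (List.mem_finRange i)

theorem sum_charProj [NeZero d] {x : Fin n → A} (hd : ∀ i, x i ^ d = 1) :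
    ∑ χ : Chr d n, charProj χ x = 1 := by
  let := Fintype.ofFinite (rootsOfUnity d ℂ)
  have h := (MultilinearMap.mkPiAlgebraFin K n A).map_sum
    (fun (i : Fin n) (z : rootsOfUnity d ℂ) => proj d ((z : ℂˣ) : ℂ) (x i))
  simp only [MultilinearMap.mkPiAlgebraFin_apply, sum_proj (hd _)] at h
  have h1 : (List.ofFn fun _ : Fin n => (1 : A)).prod = 1 := by simp
  rw [h1] at h
  refine Eq.trans (Finset.sum_congr ?_ fun _ _ => rfl) h.symm
  ext
  simp only [Finset.mem_univ]

end Projections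

/-! ### The idempotents of the Yokonuma-Hecke algebra -/

section Yokonuma

variable {d n : ℕ}

/-- The quotient map from the free algebra to the Yokonuma-Hecke algebra. -/
def yokMk (d n : ℕ) : FreeAlgebra K (YGen n) →ₐ[K] Yok d n :=
  RingQuot.mkAlgHom K (YRel d n)

theorem yokMk_g (i : Fin (n - 1)) : yokMk d n (Free.g i) = g d i := rfl

theorem yokMk_t (j : Fin n) : yokMk d n (Free.t j) = t d j := rfl

theorem yokMk_rel {x y : FreeAlgebra K (YGen n)} (h : YRel d n x y) : yokMk d n x = yokMk d n y :=
  RingQuot.mkAlgHom_rel K h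

/-- The element `(1/d) ∑_{0 ≤ r < d} x^r y^{d-r}`, whose value at `t_i` and `t_{i+1}` is `e_i`. -/
def avg (d : ℕ) {A : Type*} [Ring A] [Algebra K A] (x y : A) : A :=
  cst (d : ℂ)⁻¹ • ∑ r ∈ Finset.range d, x ^ r * y ^ (d - r)

theorem avg_mul_of_eigen [NeZero d] {A : Type*} [Ring A] [Algebra K A] {x y a : A} {z ω : ℂ}
    (hz : z ^ d = 1) (hω : ω ^ d = 1) (hx : x * a = cst z • a) (hy : y * a = cst ω • a) :
    avg d x y * a = if z = ω then a else 0 := by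
  have e : ∀ r, x ^ r * y ^ (d - r) * a = cst (z ^ r * ω ^ (d - r)) • a := by
    intro r
    rw [mul_assoc, pow_mul_of_eigen hy, mul_smul_comm, pow_mul_of_eigen hx, smul_smul, cst_eq,
      cst_eq, cst_eq, map_mul, mul_comm, map_pow, map_pow]
  rw [avg, smul_mul_assoc, Finset.sum_mul, Finset.sum_congr rfl fun r _ => e r,
    cst_inv_smul_sum_eq hz hω]

theorem map_free_e {A : Type*} [Ring A] [Algebra K A] (F : FreeAlgebra K (YGen n) →ₐ[K] A)
    (i : Fin (n - 1)) : F (Free.e d i) = avg d (F (Free.t (lo i))) (F (Free.t (hi i))) := by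
  simp only [Free.e, avg, map_smul, map_sum, map_mul, map_pow]
  rfl

theorem g_comm (i j : Fin (n - 1)) (h : (i : ℕ) + 1 < j) : g d i * g d j = g d j * g d i := by
  simpa only [map_mul, yokMk_g] using yokMk_rel (YRel.comm (d := d) i j (Or.inl h))

theorem g_braid (i j : Fin (n - 1)) (h : (i : ℕ) + 1 = j) :
    g d i * g d j * g d i = g d j * g d i * g d j := by
  simpa only [map_mul, yokMk_g] using yokMk_rel (YRel.braid (d := d) i j h)

theorem t_comm (i j : Fin n) : Commute (t d i) (t d j) := by
  have := yokMk_rel (YRel.tcomm (d := d) i j)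
  rw [map_mul, map_mul] at this
  exact this

theorem g_mul_t (i : Fin (n - 1)) (j : Fin n) : g d i * t d j = t d (s i j) * g d i := by
  simpa only [map_mul, yokMk_t, yokMk_g] using yokMk_rel (YRel.gt (d := d) i j)

theorem t_pow (j : Fin n) : t d j ^ d = 1 := by
  simpa only [map_pow, map_one, yokMk_t] using yokMk_rel (YRel.tpow (d := d) j)

theorem g_quad (i : Fin (n - 1)) : g d i * g d i =
    algebraMap K (Yok d n) (u ^ 2) + v • (avg d (t d (lo i)) (t d (hi i)) * g d i) := by
  simpa only [map_pow, map_add, map_smul, map_mul, AlgHom.commutes, map_free_e, yokMk_t, yokMk_g,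
    pow_two (g d i)] using yokMk_rel (YRel.quad (d := d) i)

theorem yok_induction {P : Yok d n → Prop} (algebraMap : ∀ c, P (algebraMap K _ c))
    (g : ∀ i, P (g d i)) (t : ∀ j, P (t d j)) (mul : ∀ x y, P x → P y → P (x * y))
    (add : ∀ x y, P x → P y → P (x + y)) (x : Yok d n) : P x := by
  obtain ⟨x, rfl⟩ := RingQuot.mkAlgHom_surjective K (YRel d n) x
  induction x using FreeAlgebra.induction with
  | grade0 c => rw [AlgHom.commutes]; exact algebraMap c
  | grade1 x =>
    rcases x with i | j
    · exact g i
    · exact t j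
  | mul a b ha hb => rw [map_mul]; exact mul _ _ ha hb
  | add a b ha hb => rw [map_add]; exact add _ _ ha hb

theorem E_eq_charProj (χ : Chr d n) : E χ = charProj χ (t d) := rfl

theorem act_one (χ : Chr d n) : act 1 χ = χ := rfl

theorem act_mul (w y : Equiv.Perm (Fin n)) (χ : Chr d n) : act (w * y) χ = act w (act y χ) := by
  funext i
  simp [act]

theorem act_inv_act (w : Equiv.Perm (Fin n)) (χ : Chr d n) : act w⁻¹ (act w χ) = χ := by
  rw [← act_mul, inv_mul_cancel, act_one]

theorem act_injective (w : Equiv.Perm (Fin n)) : Function.Injective (act (d := d) w) :=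
  Function.LeftInverse.injective (act_inv_act w)

theorem commute_t_E (χ : Chr d n) (j : Fin n) : Commute (t d j) (E χ) :=
  commute_charProj (t_comm j) χ

theorem commute_avg_E (i : Fin (n - 1)) (χ : Chr d n) :
    Commute (avg d (t d (lo i)) (t d (hi i))) (E χ) :=
  (Commute.sum_left _ _ _ fun _ _ => ((commute_t_E χ _).pow_left _).mul_left
    ((commute_t_E χ _).pow_left _)).smul_left _

theorem gt_one : gt d (1 : Equiv.Perm (Fin n)) = 1 := by
  rw [gt, reducedExpr_one, len_one, pow_zero, one_smul]; rfl

theorem gt_s_mul {i : Fin (n - 1)} {w : Equiv.Perm (Fin n)} (h : w⁻¹ (lo i) < w⁻¹ (hi i)) :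
    gt d (s i * w) = uInv • (g d i * gt d w) := by
  rw [gt, gt, len_s_mul h, wordG, prod_map_reducedExpr_s_mul g_comm g_braid h, mul_smul_comm,
    smul_smul, ← pow_succ']
  rfl

theorem g_mul_gt {i : Fin (n - 1)} {w : Equiv.Perm (Fin n)} (h : w⁻¹ (lo i) < w⁻¹ (hi i)) :
    g d i * gt d w = u • gt d (s i * w) := by
  rw [gt_s_mul h, smul_smul, u_mul_uInv, one_smul]

theorem g_mul_gt_of_descent {i : Fin (n - 1)} {w : Equiv.Perm (Fin n)}
    (h : w⁻¹ (hi i) < w⁻¹ (lo i)) : g d i * gt d w =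
      u • gt d (s i * w) + v • (avg d (t d (lo i)) (t d (hi i)) * gt d w) := by
  have h' := (lt_or_descent i w).resolve_left (lt_asymm h)
  have e := gt_s_mul (d := d) h'
  rw [s_mul_s_mul] at e
  rw [e, mul_smul_comm, ← mul_assoc, g_quad, add_mul, smul_add, smul_mul_assoc, smul_comm uInv v,
    Algebra.algebraMap_eq_smul_one, smul_mul_assoc, one_mul, smul_smul, pow_two, ← mul_assoc,
    uInv_mul_u, one_mul, mul_smul_comm, mul_assoc]

variable [NeZero d]

theorem sum_E : ∑ χ : Chr d n, E χ = 1 := sum_charProj t_pow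

theorem t_mul_E (χ : Chr d n) (j : Fin n) : t d j * E χ = cst (val χ j) • E χ :=
  mul_charProj t_comm t_pow χ j

open scoped Classical in
theorem E_mul_E (χ ψ : Chr d n) : E χ * E ψ = if χ = ψ then E ψ else 0 :=
  charProj_mul_of_eigen χ ψ (t_mul_E ψ)

theorem E_mul_self (χ : Chr d n) : E χ * E χ = E χ := by
  rw [E_mul_E, if_pos rfl]

theorem g_mul_E (i : Fin (n - 1)) (χ : Chr d n) : g d i * E χ = E (act (s i) χ) * g d i := by
  classical
  -- `g_i E_ψ` is a joint eigenvector of the `t_j` with character `s_i(ψ)`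
  have key : ∀ θ ψ : Chr d n,
      E θ * (g d i * E ψ) = if θ = act (s i) ψ then g d i * E ψ else 0 := by
    intro θ ψ
    refine charProj_mul_of_eigen θ _ fun j => ?_
    have h := g_mul_t (d := d) i (s i j)
    rw [s_s] at h
    rw [← mul_assoc, ← h, mul_assoc, t_mul_E, mul_smul_comm]
    simp only [val, act, s_inv]
  have h : E (act (s i) χ) * g d i = ∑ ψ : Chr d n, E (act (s i) χ) * (g d i * E ψ) := by
    rw [← Finset.mul_sum, ← Finset.mul_sum, sum_E, mul_one]
  rw [h]
  simp only [key, (act_injective (s i)).eq_iff]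
  rw [Finset.sum_ite_eq Finset.univ χ, if_pos (Finset.mem_univ _)]

theorem avg_mul_E (i : Fin (n - 1)) (χ : Chr d n) :
    avg d (t d (lo i)) (t d (hi i)) * E χ = if χ (lo i) = χ (hi i) then E χ else 0 := by
  rw [avg_mul_of_eigen (val_pow χ (lo i)) (val_pow χ (hi i)) (t_mul_E χ _) (t_mul_E χ _)]
  simp only [val_inj]

theorem gt_mul_E (w : Equiv.Perm (Fin n)) (χ : Chr d n) :
    gt d w * E χ = E (act w χ) * gt d w := by
  induction w using perm_induction with
  | one => rw [gt_one, act_one, one_mul, mul_one]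
  | step i w h ih =>
    rw [gt_s_mul h, smul_mul_assoc, mul_assoc, ih, ← mul_assoc, g_mul_E, mul_smul_comm, mul_assoc,
      act_mul]

/-- The elements `E_χ g̃_w` span the Yokonuma-Hecke algebra. -/
theorem span_E_mul_gt :
    Submodule.span K (Set.range fun p : Chr d n × Equiv.Perm (Fin n) => E p.1 * gt d p.2) = ⊤ := by
  set S := Submodule.span K (Set.range fun p : Chr d n × Equiv.Perm (Fin n) => E p.1 * gt d p.2)
  have hS : ∀ χ w, E χ * gt d w ∈ S := fun χ w => Submodule.subset_span ⟨(χ, w), rfl⟩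
  have key : ∀ x : Yok d n, ∀ y ∈ S, x * y ∈ S := by
    intro x
    have gens : ∀ x : Yok d n, (∀ χ w, x * (E χ * gt d w) ∈ S) → ∀ y ∈ S, x * y ∈ S := by
      intro x hx y hy
      induction hy using Submodule.span_induction with
      | mem y hy => obtain ⟨p, rfl⟩ := hy; exact hx _ _
      | zero => rw [mul_zero]; exact S.zero_mem
      | add a b _ _ ha hb => rw [mul_add]; exact S.add_mem ha hb
      | smul c a _ ha => rw [mul_smul_comm]; exact S.smul_mem _ ha
    induction x using yok_induction with
    | algebraMap c => intro y hy; rw [← Algebra.smul_def]; exact S.smul_mem _ hy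
    | add a b ha hb => intro y hy; rw [add_mul]; exact S.add_mem (ha y hy) (hb y hy)
    | mul a b ha hb => intro y hy; rw [mul_assoc]; exact ha _ (hb y hy)
    | t j =>
      refine gens _ fun χ w => ?_
      rw [← mul_assoc, t_mul_E, smul_mul_assoc]
      exact S.smul_mem _ (hS _ _)
    | g i =>
      refine gens _ fun χ w => ?_
      rw [← mul_assoc, g_mul_E, mul_assoc]
      rcases lt_or_gt_of_ne fun e => (lo_lt_hi i).ne (w⁻¹.injective e) with h | h
      · rw [g_mul_gt h, mul_smul_comm]
        exact S.smul_mem _ (hS _ _)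
      · rw [g_mul_gt_of_descent h, mul_add, mul_smul_comm, mul_smul_comm, ← mul_assoc,
          ← (commute_avg_E i _).eq, avg_mul_E]
        refine S.add_mem (S.smul_mem _ (hS _ _)) (S.smul_mem _ ?_)
        split_ifs
        · exact hS _ _
        · rw [zero_mul]; exact S.zero_mem
  rw [eq_top_iff]
  intro x _
  have h1 : (1 : Yok d n) ∈ S := by
    rw [← sum_E]
    refine S.sum_mem fun χ _ => ?_
    simpa only [gt_one, mul_one] using hS χ 1
  simpa only [mul_one] using key x 1 h1

end Yokonuma

/-! ### The orbit of characters attached to a composition -/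

section Orbit

variable {d n : ℕ} (ξ : Fin d ≃ rootsOfUnity d ℂ) (μ : Comp d n)

theorem act_chi1_apply (w : Equiv.Perm (Fin n)) (x : Fin n) :
    act w (chi1 ξ μ) x = ξ (block μ (w⁻¹ x)) := rfl

theorem act_chi1_eq_iff {w w' : Equiv.Perm (Fin n)} :
    act w (chi1 ξ μ) = act w' (chi1 ξ μ) ↔ w⁻¹ * w' ∈ young μ := by
  rw [mem_young_iff, funext_iff]
  simp only [act_chi1_apply, ξ.injective.eq_iff]
  constructor
  · intro h x
    simpa using h (w' x)
  · intro h x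
    simpa using h (w'⁻¹ x)

theorem card_fiber_chi1 (a : Fin d) : Nat.card {x : Fin n // chi1 ξ μ x = ξ a} = μ.1 a := by
  rw [← card_block μ a, ← Nat.card_eq_fintype_card]
  exact Nat.card_congr ((Equiv.refl _).subtypeEquiv fun x => ξ.injective.eq_iff)

theorem act_chi1_mem_orbit (w : Equiv.Perm (Fin n)) : act w (chi1 ξ μ) ∈ orbit ξ μ := by
  intro a
  rw [← card_fiber_chi1 ξ μ a]
  exact Nat.card_congr (w⁻¹.subtypeEquiv fun x => Iff.rfl)

/-- The set `O(μ)` is a single orbit of the symmetric group. -/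
theorem exists_act_chi1_eq {χ : Chr d n} (h : χ ∈ orbit ξ μ) : ∃ w, act w (chi1 ξ μ) = χ := by
  have e : ∀ z : rootsOfUnity d ℂ, Nonempty ({x // chi1 ξ μ x = z} ≃ {x // χ x = z}) := by
    intro z
    obtain ⟨a, rfl⟩ := ξ.surjective z
    exact ⟨(Finite.equivFinOfCardEq (card_fiber_chi1 ξ μ a)).trans
      (Finite.equivFinOfCardEq (h a)).symm⟩
  let w : Equiv.Perm (Fin n) := Equiv.ofFiberEquiv fun z => (e z).some
  refine ⟨w, funext fun x => ?_⟩
  have := Equiv.ofFiberEquiv_map (fun z => (e z).some) (w⁻¹ x)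
  rw [act, ← this]
  exact congrArg χ (apply_inv_apply w x)

/-- Each character lies in `O(μ)` for exactly one composition `μ`. -/
theorem existsUnique_mem_orbit (χ : Chr d n) : ∃! μ : Comp d n, χ ∈ orbit ξ μ := by
  refine ⟨⟨fun a => Nat.card {j : Fin n // χ j = ξ a}, ?_⟩, fun a => rfl,
    fun ν hν => Subtype.ext (funext fun a => (hν a).symm)⟩
  have h : ∀ j a, χ j = ξ a ↔ ξ.symm (χ j) = a := fun j a => ξ.symm_apply_eq.symm
  simp only [Nat.card_eq_fintype_card, Fintype.card_subtype, h]
  rw [← Finset.card_eq_sum_card_fiberwise (f := fun j => ξ.symm (χ j)) (t := Finset.univ)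
    (s := Finset.univ) (fun _ _ => Finset.mem_coe.2 (Finset.mem_univ _)), Finset.card_univ,
    Fintype.card_fin]

/-- The orbit-stabilizer relation for `O(μ)`, whose stabilizer is the Young subgroup. -/
theorem m_mul_prod_factorial : m ξ μ * ∏ a, (μ.1 a)! = n ! := by
  choose r hr using fun χ : orbit ξ μ => exists_act_chi1_eq ξ μ χ.2
  have hmem : ∀ w, (r ⟨act w (chi1 ξ μ), act_chi1_mem_orbit ξ μ w⟩)⁻¹ * w ∈ young μ :=
    fun w => (act_chi1_eq_iff ξ μ).1 (hr _)
  have hact : ∀ (χ : orbit ξ μ) (y : young μ),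
      act (r χ * (y : Equiv.Perm (Fin n))) (chi1 ξ μ) = χ := by
    intro χ y
    rw [← hr χ, eq_comm, act_chi1_eq_iff, inv_mul_cancel_left]
    exact y.2
  let e : Equiv.Perm (Fin n) ≃ orbit ξ μ × young μ :=
    { toFun := fun w => (⟨act w (chi1 ξ μ), act_chi1_mem_orbit ξ μ w⟩, ⟨_, hmem w⟩)
      invFun := fun p => r p.1 * p.2
      left_inv := fun w => mul_inv_cancel_left _ _
      right_inv := by
        rintro ⟨χ, y⟩
        have h : (⟨act (r χ * (y : Equiv.Perm (Fin n))) (chi1 ξ μ), act_chi1_mem_orbit ξ μ _⟩ :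
            orbit ξ μ) = χ :=
          Subtype.ext (hact χ y)
        refine Prod.ext h (Subtype.ext ?_)
        simp only [h, inv_mul_cancel_left] }
  have h := Nat.card_congr e
  rw [Nat.card_prod, Nat.card_eq_fintype_card (α := young μ), card_young, Nat.card_perm,
    Nat.card_fin] at h
  exact h.symm

end Orbit

/-! ### Minimal length coset representatives -/

section Distinguished

variable {d n : ℕ} {ξ : Fin d ≃ rootsOfUnity d ℂ} {μ : Comp d n}
  {π : Fin (m ξ μ) → Equiv.Perm (Fin n)}

namespace IsDistinguished

variable (hπ : IsDistinguished ξ μ π)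

/-- The index of the coset of `w`. -/
def idx (w : Equiv.Perm (Fin n)) : Fin (m ξ μ) := (hπ.represents w).choose

theorem idx_spec (w : Equiv.Perm (Fin n)) : (π (hπ.idx w))⁻¹ * w ∈ young μ :=
  (hπ.represents w).choose_spec.1

theorem idx_eq {w : Equiv.Perm (Fin n)} {k : Fin (m ξ μ)} (h : (π k)⁻¹ * w ∈ young μ) :
    hπ.idx w = k :=
  ((hπ.represents w).choose_spec.2 k h).symm

theorem idx_pi (k : Fin (m ξ μ)) : hπ.idx (π k) = k :=
  hπ.idx_eq (by rw [inv_mul_cancel]; exact one_mem _)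

/-- The action of the symmetric group on the set of indices of cosets. -/
def move (w : Equiv.Perm (Fin n)) (k : Fin (m ξ μ)) : Fin (m ξ μ) := hπ.idx (w * π k)

theorem move_spec (w : Equiv.Perm (Fin n)) (k : Fin (m ξ μ)) :
    (π (hπ.move w k))⁻¹ * (w * π k) ∈ young μ :=
  hπ.idx_spec _

theorem move_eq {w : Equiv.Perm (Fin n)} {k l : Fin (m ξ μ)} (h : (π l)⁻¹ * (w * π k) ∈ young μ) :
    hπ.move w k = l :=
  hπ.idx_eq h

theorem move_one (k : Fin (m ξ μ)) : hπ.move 1 k = k :=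
  hπ.move_eq (by rw [one_mul, inv_mul_cancel]; exact one_mem _)

theorem move_mul (w y : Equiv.Perm (Fin n)) (k : Fin (m ξ μ)) :
    hπ.move (w * y) k = hπ.move w (hπ.move y k) := by
  refine hπ.move_eq ?_
  have h := mul_mem (hπ.move_spec w (hπ.move y k)) (hπ.move_spec y k)
  simpa only [mul_assoc, mul_inv_cancel_left] using h

theorem move_inv_eq {w : Equiv.Perm (Fin n)} {k l : Fin (m ξ μ)} :
    hπ.move w⁻¹ k = l ↔ hπ.move w l = k := by
  constructor
  · rintro rfl; rw [← move_mul, mul_inv_cancel, move_one]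
  · rintro rfl; rw [← move_mul, inv_mul_cancel, move_one]

theorem act_pi_chi1 (w : Equiv.Perm (Fin n)) (k : Fin (m ξ μ)) :
    act w (act (π k) (chi1 ξ μ)) = act (π (hπ.move w k)) (chi1 ξ μ) := by
  rw [← act_mul, eq_comm, act_chi1_eq_iff]
  exact hπ.move_spec w k

theorem block_move (w : Equiv.Perm (Fin n)) (k : Fin (m ξ μ)) (x : Fin n) :
    block μ ((π (hπ.move w k))⁻¹ x) = block μ ((π k)⁻¹ (w⁻¹ x)) :=
  ξ.injective (congrFun (hπ.act_pi_chi1 w k) x).symm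

theorem act_pi_chi1_injective (hπ : IsDistinguished ξ μ π) :
    Function.Injective fun k => act (π k) (chi1 ξ μ) := by
  intro k l h
  rw [← hπ.idx_pi l]
  exact (hπ.idx_eq ((act_chi1_eq_iff ξ μ).1 h)).symm

theorem exists_act_pi_chi1 (hπ : IsDistinguished ξ μ π) {χ : Chr d n} (h : χ ∈ orbit ξ μ) :
    ∃ k, act (π k) (chi1 ξ μ) = χ := by
  obtain ⟨w, rfl⟩ := exists_act_chi1_eq ξ μ h
  exact ⟨hπ.idx w, (act_chi1_eq_iff ξ μ).2 (hπ.idx_spec w)⟩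

/-- A minimal length coset representative is increasing on each block. -/
theorem pi_lt (hπ : IsDistinguished ξ μ π) (k : Fin (m ξ μ)) {x y : Fin n}
    (hb : block μ x = block μ y) (h : x < y) :
    π k x < π k y := by
  -- a descent inside a block could be removed by multiplying with an element of the Young subgroup
  have adj : ∀ i ∈ I μ, π k (lo i) < π k (hi i) := by
    intro i hi'
    by_contra hlt
    have hlt' : π k (hi i) < π k (lo i) :=
      lt_of_le_of_ne (not_lt.1 hlt) ((π k).injective.ne (lo_lt_hi i).ne')
    have h1 := len_s_mul_add_one (i := i) (w := (π k)⁻¹) (by rwa [inv_inv])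
    have h2 := hπ.minimal k (s i) (s_mem_young μ hi')
    rw [← len_inv (π k * s i), mul_inv_rev, s_inv, ← len_inv (π k)] at h2
    omega
  obtain ⟨N, hN⟩ : ∃ N : ℕ, (y : ℕ) = x + N + 1 := Nat.exists_eq_add_of_lt h
  induction N generalizing x with
  | zero =>
    have hy := y.2
    have := adj ⟨x, by omega⟩ (by
      rw [mem_I]
      exact hb.trans (congrArg _ (Fin.ext hN)))
    exact this.trans_eq (congrArg _ (Fin.ext hN.symm))
  | succ N ih =>
    have hy := y.2
    let i : Fin (n - 1) := ⟨x, by omega⟩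
    have hiy : hi i < y := by
      rw [Fin.lt_def, hi_val]
      change (x : ℕ) + 1 < y
      omega
    have e1 : block μ x ≤ block μ (hi i) := block_mono μ (lo_lt_hi i).le
    have e2 : block μ (hi i) ≤ block μ y := block_mono μ hiy.le
    have e : block μ x = block μ (hi i) := le_antisymm e1 (hb ▸ e2)
    refine (adj i e).trans (ih (e.symm.trans hb) hiy ?_)
    rw [hi_val, hN]
    change _ = (x : ℕ) + 1 + N + 1
    omega

theorem pi_inv_lt (hπ : IsDistinguished ξ μ π) (k : Fin (m ξ μ)) {x y : Fin n}
    (hb : block μ ((π k)⁻¹ x) = block μ ((π k)⁻¹ y)) (h : x < y) : (π k)⁻¹ x < (π k)⁻¹ y := by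
  refine lt_of_le_of_ne (not_lt.1 fun h' => ?_) ((π k)⁻¹.injective.ne h.ne)
  have := hπ.pi_lt k hb.symm h'
  rw [apply_inv_apply, apply_inv_apply] at this
  exact lt_asymm this h

/-- If the character `χ_k` takes distinct values at `i` and `i + 1`, then `s i * π k` is again a
minimal length coset representative. -/
theorem pi_move_of_ne {k : Fin (m ξ μ)} {i : Fin (n - 1)}
    (h : block μ ((π k)⁻¹ (lo i)) ≠ block μ ((π k)⁻¹ (hi i))) :
    π (hπ.move (s i) k) = s i * π k := by
  have hw := hπ.move_spec (s i) k
  rw [← inv_mul_eq_one]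
  refine eq_one_of_lt fun j => ?_
  by_cases hj : j ∈ I μ
  · have hb : block μ (lo j) = block μ (hi j) := hj
    rw [Equiv.Perm.mul_apply, Equiv.Perm.mul_apply]
    refine hπ.pi_inv_lt _ ?_ (s_lt_s (hπ.pi_lt k hb (lo_lt_hi j)) ?_)
    · exact (hw _).trans (hb.trans (hw _).symm)
    · rintro ⟨e1, e2⟩
      apply h
      rw [← e1, ← e2, inv_apply_apply, inv_apply_apply, hb]
  · exact lt_of_notMem_I μ hw hj

theorem move_of_eq {k : Fin (m ξ μ)} {i : Fin (n - 1)}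
    (h : block μ ((π k)⁻¹ (lo i)) = block μ ((π k)⁻¹ (hi i))) : hπ.move (s i) k = k := by
  refine hπ.move_eq ?_
  rw [← mul_assoc, s_eq, Equiv.mul_swap_eq_swap_mul, inv_mul_cancel_right]
  exact swap_mem_young μ h

theorem pi_inv_move {k : Fin (m ξ μ)} {i : Fin (n - 1)} (x : Fin n) :
    (π (hπ.move (s i) k))⁻¹ x = if block μ ((π k)⁻¹ (lo i)) = block μ ((π k)⁻¹ (hi i)) then
      (π k)⁻¹ x else (π k)⁻¹ (s i x) := by
  split_ifs with h
  · rw [hπ.move_of_eq h]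
  · rw [hπ.pi_move_of_ne h, mul_inv_rev, s_inv, Equiv.Perm.mul_apply]

/-- If the character `χ_k` takes the same value at `i` and `i + 1`, then `(π k)⁻¹` sends these
letters to neighbours. -/
theorem pi_inv_hi (hπ : IsDistinguished ξ μ π) {k : Fin (m ξ μ)} {i : Fin (n - 1)}
    (h : block μ ((π k)⁻¹ (lo i)) = block μ ((π k)⁻¹ (hi i))) :
    ((π k)⁻¹ (hi i) : ℕ) = (π k)⁻¹ (lo i) + 1 := by
  have hlt := hπ.pi_inv_lt k h (lo_lt_hi i)
  by_contra hne
  have hlt' := Fin.lt_def.1 hlt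
  let z : Fin n := ⟨(π k)⁻¹ (lo i) + 1, by have := ((π k)⁻¹ (hi i)).2; omega⟩
  have hz1 : (π k)⁻¹ (lo i) < z := by rw [Fin.lt_def]; change _ < _ + 1; omega
  have hz2 : z < (π k)⁻¹ (hi i) := by rw [Fin.lt_def]; change _ + 1 < _; omega
  have e1 : block μ ((π k)⁻¹ (lo i)) = block μ z :=
    le_antisymm (block_mono μ hz1.le) (h ▸ block_mono μ hz2.le)
  have h1 := hπ.pi_lt k e1 hz1
  have h2 := hπ.pi_lt k (e1.symm.trans h) hz2
  rw [apply_inv_apply] at h1 h2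
  rw [Fin.lt_def] at h1 h2
  rw [lo_val] at h1
  rw [hi_val] at h2
  omega

end IsDistinguished

end Distinguished

/-! ### Monomial matrices -/

section Monomial

variable {N R : Type*} [DecidableEq N] [Semiring R]

/-- The matrix whose `k`-th row has the entry `a k` in column `f k`, and zeros elsewhere. -/
def mono (f : N → N) (a : N → R) : Matrix N N R := Matrix.of fun k l => if l = f k then a k else 0

theorem mono_apply (f : N → N) (a : N → R) (k l : N) :
    mono f a k l = if l = f k then a k else 0 := rfl

theorem mono_mul_mono [Fintype N] (f f' : N → N) (a a' : N → R) :
    mono f a * mono f' a' = mono (f' ∘ f) fun k => a k * a' (f k) := by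
  ext k l
  simp only [Matrix.mul_apply, mono_apply, ite_mul, zero_mul, Function.comp_apply]
  rw [Finset.sum_ite_eq' Finset.univ (f k), if_pos (Finset.mem_univ _), mul_ite, mul_zero]

theorem diagonal_eq_mono (a : N → R) : Matrix.diagonal a = mono id a := by
  ext k l
  rw [Matrix.diagonal_apply, mono_apply]
  simp only [id, eq_comm]

theorem mono_smul {S : Type*} [SMulZeroClass S R] (c : S) (f : N → N) (a : N → R) :
    c • mono f a = mono f fun k => c • a k := by
  ext k l
  simp [mono_apply]

theorem mono_congr {f f' : N → N} {a a' : N → R} (h : ∀ k, f k = f' k) (h' : ∀ k, a k = a' k) :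
    mono f a = mono f' a' := by
  rw [funext h, funext h']

end Monomial

/-! ### The generators of the algebra of a Young subgroup -/

section Gen

variable {d n : ℕ} (μ : Comp d n)

/-- The generator of `H^μ` attached to the letters `x`, `y` if these are neighbours, in this order,
in the same block, and `u` otherwise. -/
def gen (x y : Fin n) : Hmu μ :=
  if h : block μ x = block μ y ∧ (y : ℕ) = x + 1 then
    Tmu μ ⟨x, by have := y.2; omega⟩ (h.1.trans (congrArg _ (Fin.ext h.2)))
  else algebraMap K _ u

theorem gen_of_ne {x y : Fin n} (h : block μ x ≠ block μ y) : gen μ x y = algebraMap K _ u :=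
  dif_neg fun h' => h h'.1

theorem gen_cases {x y : Fin n} (h : block μ x = block μ y → (y : ℕ) = x + 1) :
    block μ x ≠ block μ y ∧ gen μ x y = algebraMap K _ u ∨
      ∃ (i : Fin (n - 1)) (hi' : i ∈ I μ), lo i = x ∧ hi i = y ∧ gen μ x y = Tmu μ i hi' := by
  by_cases hb : block μ x = block μ y
  · right
    have hy := h hb
    have hx : (x : ℕ) < n - 1 := by have := y.2; omega
    exact ⟨⟨x, hx⟩, hb.trans (congrArg _ (Fin.ext hy)), rfl, Fin.ext hy.symm, dif_pos ⟨hb, hy⟩⟩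
  · exact Or.inl ⟨hb, gen_of_ne μ hb⟩

theorem gen_commute {x y x' y' : Fin n} (h : block μ x = block μ y → (y : ℕ) = x + 1)
    (h' : block μ x' = block μ y' → (y' : ℕ) = x' + 1) (h1 : x ≠ x') (h2 : x ≠ y') (h3 : y ≠ x') :
    Commute (gen μ x y) (gen μ x' y') := by
  rcases gen_cases μ h with ⟨-, e⟩ | ⟨i, hi1, rfl, rfl, e⟩
  · rw [e]; exact Algebra.commute_algebraMap_left _ _
  rcases gen_cases μ h' with ⟨-, e'⟩ | ⟨j, hj1, rfl, rfl, e'⟩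
  · rw [e']; exact Algebra.commute_algebraMap_right _ _
  rw [e, e']
  refine Subtype.ext (T_comm i j ?_)
  simp only [ne_eq, Fin.ext_iff, lo_val, hi_val] at h1 h2 h3
  omega

theorem gen_braid {x y z : Fin n} (h : block μ x = block μ y → (y : ℕ) = x + 1)
    (h' : block μ y = block μ z → (z : ℕ) = y + 1) (hxy : block μ x = block μ y)
    (hyz : block μ y = block μ z) :
    gen μ x y * gen μ y z * gen μ x y = gen μ y z * gen μ x y * gen μ y z := by
  rcases gen_cases μ h with ⟨e, -⟩ | ⟨i, hi1, rfl, hy, e⟩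
  · exact absurd hxy e
  rcases gen_cases μ h' with ⟨e', -⟩ | ⟨j, hj1, hy', rfl, e'⟩
  · exact absurd hyz e'
  rw [e, e']
  refine Subtype.ext (T_braid i j ?_)
  have := hy.trans hy'.symm
  rwa [Fin.ext_iff, hi_val, lo_val] at this

theorem gen_quad {x y : Fin n} (h : block μ x = block μ y → (y : ℕ) = x + 1)
    (hxy : block μ x = block μ y) :
    gen μ x y * gen μ x y = algebraMap K _ (u ^ 2) + v • gen μ x y := by
  rcases gen_cases μ h with ⟨e, -⟩ | ⟨i, hi1, rfl, hy, e⟩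
  · exact absurd hxy e
  rw [e]
  exact Subtype.ext (T_quad i)

end Gen

/-! ### The matrix representation of the Yokonuma-Hecke algebra -/

section Representation

variable {d n : ℕ} {ξ : Fin d ≃ rootsOfUnity d ℂ} {μ : Comp d n}
  {π : Fin (m ξ μ) → Equiv.Perm (Fin n)}

namespace IsDistinguished

variable (hπ : IsDistinguished ξ μ π)

/-- The matrix by which `g_i` acts: it exchanges `χ_k` and `s_i(χ_k)` with coefficient `u` if these
differ, and is a generator of `H^μ` on the diagonal at `k` if they agree. -/
def gMat (i : Fin (n - 1)) : Matrix (Fin (m ξ μ)) (Fin (m ξ μ)) (Hmu μ) :=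
  mono (hπ.move (s i)) fun k => gen μ ((π k)⁻¹ (lo i)) ((π k)⁻¹ (hi i))

/-- The eigenvalues of `t_j`: the values of the characters `χ_k` at `t_j`. -/
def tVal (_hπ : IsDistinguished ξ μ π) (j : Fin n) (k : Fin (m ξ μ)) : Hmu μ :=
  algebraMap K _ (cst (val (act (π k) (chi1 ξ μ)) j))

/-- The diagonal matrix by which `t_j` acts. -/
def tMat (j : Fin n) : Matrix (Fin (m ξ μ)) (Fin (m ξ μ)) (Hmu μ) := Matrix.diagonal (hπ.tVal j)

theorem neighbour (hπ : IsDistinguished ξ μ π) (k : Fin (m ξ μ)) (i : Fin (n - 1)) :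
    block μ ((π k)⁻¹ (lo i)) = block μ ((π k)⁻¹ (hi i)) →
      ((π k)⁻¹ (hi i) : ℕ) = (π k)⁻¹ (lo i) + 1 := hπ.pi_inv_hi

theorem gMat_comm (i j : Fin (n - 1)) (h : (i : ℕ) + 1 < j) :
    hπ.gMat i * hπ.gMat j = hπ.gMat j * hπ.gMat i := by
  rw [gMat, gMat, mono_mul_mono, mono_mul_mono]
  refine mono_congr (fun k => ?_) fun k => ?_
  · rw [Function.comp_apply, Function.comp_apply, ← move_mul, ← move_mul, s_comm (Or.inl h)]
  · simp only [hπ.pi_inv_move, s_far (n := n) (i := i) (j := j) (Or.inl h),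
      s_far (n := n) (i := j) (j := i) (Or.inr h), ite_self]
    refine gen_commute μ (hπ.neighbour k i) (hπ.neighbour k j) ?_ ?_ ?_ <;>
      refine (π k)⁻¹.injective.ne ?_ <;> simp only [ne_eq, Fin.ext_iff, lo_val, hi_val] <;> omega

theorem gMat_braid (i j : Fin (n - 1)) (h : (i : ℕ) + 1 = j) :
    hπ.gMat i * hπ.gMat j * hπ.gMat i = hπ.gMat j * hπ.gMat i * hπ.gMat j := by
  simp only [gMat, mono_mul_mono]
  refine mono_congr (fun k => ?_) fun k => ?_
  · simp only [Function.comp_apply, ← move_mul, ← mul_assoc, s_braid h]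
  · have e := hi_eq_lo h
    have e1 : s i (lo j) = lo i := by rw [← e, s_hi]
    have e2 := s_lo_adj h
    have e3 := s_hi_adj h
    have n1 := hπ.neighbour k i
    have n2 := hπ.neighbour k j
    rw [e] at n1
    simp only [Function.comp_apply, hπ.pi_inv_move, s_lo, s_hi, e, e1, e2, e3]
    generalize (π k)⁻¹ (lo i) = x at n1 n2 ⊢
    generalize (π k)⁻¹ (lo j) = y at n1 n2 ⊢
    generalize (π k)⁻¹ (hi j) = z at n1 n2 ⊢
    -- a letter passes its neighbour exactly when they lie in different blocks, at the cost of the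
    -- scalar `u`; only when all three blocks agree is the braid relation of `H^μ` needed
    by_cases h1 : block μ x = block μ y <;> by_cases h2 : block μ y = block μ z
    · have h3 := h1.trans h2
      simp only [h1, h2, if_true]
      exact gen_braid μ n1 n2 h1 h2
    · have h3 : block μ x ≠ block μ z := h1 ▸ h2
      simp only [h1, h2, if_true, if_false, gen_of_ne μ h2, gen_of_ne μ h3]
      rw [mul_assoc, ← map_mul, ← Algebra.commutes]
    · have h3 : block μ x ≠ block μ z := h2 ▸ h1
      simp only [h2, h3, if_true, if_false, gen_of_ne μ h1, gen_of_ne μ h3]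
      rw [mul_assoc (gen μ y z), ← map_mul, Algebra.commutes]
    · by_cases h3 : block μ x = block μ z
      · have h4 : ¬block μ z = block μ y := fun e => h2 e.symm
        have h5 : ¬block μ y = block μ x := fun e => h1 e.symm
        simp only [h2, h3, h4, if_true, if_false, gen_of_ne μ h1, gen_of_ne μ h2, gen_of_ne μ h4,
          gen_of_ne μ h5]
      · simp only [h1, h2, h3, if_false, gen_of_ne μ h1, gen_of_ne μ h2, gen_of_ne μ h3]

theorem val_act_pi (k : Fin (m ξ μ)) (x y : Fin n) :
    val (act (π k) (chi1 ξ μ)) x = val (act (π k) (chi1 ξ μ)) y ↔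
      block μ ((π k)⁻¹ x) = block μ ((π k)⁻¹ y) := by
  rw [val_inj, act_chi1_apply, act_chi1_apply, ξ.injective.eq_iff]

theorem tMat_comm (i j : Fin n) : hπ.tMat i * hπ.tMat j = hπ.tMat j * hπ.tMat i := by
  rw [tMat, tMat, Matrix.diagonal_mul_diagonal, Matrix.diagonal_mul_diagonal]
  congr 1
  funext k
  exact Algebra.commutes _ _

theorem gMat_mul_tMat (i : Fin (n - 1)) (j : Fin n) :
    hπ.gMat i * hπ.tMat j = hπ.tMat (s i j) * hπ.gMat i := by
  rw [tMat, tMat, diagonal_eq_mono, diagonal_eq_mono, gMat, mono_mul_mono, mono_mul_mono]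
  refine mono_congr (fun k => rfl) fun k => ?_
  have h : val (act (π (hπ.move (s i) k)) (chi1 ξ μ)) j = val (act (π k) (chi1 ξ μ)) (s i j) := by
    rw [← hπ.act_pi_chi1]
    simp only [val, act, s_inv]
  rw [tVal, tVal, h, Algebra.commutes]
  rfl

theorem tMat_pow (j : Fin n) : hπ.tMat j ^ d = 1 := by
  rw [tMat, Matrix.diagonal_pow, ← Matrix.diagonal_one]
  congr 1
  funext k
  rw [Pi.pow_apply, tVal, ← map_pow, cst_eq, ← map_pow, val_pow, map_one, map_one]

theorem avg_tMat [NeZero d] (i j : Fin n) : avg d (hπ.tMat i) (hπ.tMat j) =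
    Matrix.diagonal fun k =>
      if block μ ((π k)⁻¹ i) = block μ ((π k)⁻¹ j) then (1 : Hmu μ) else 0 := by
  have h : avg d (hπ.tMat i) (hπ.tMat j) =
      Matrix.diagonalAlgHom K (avg d (hπ.tVal i) (hπ.tVal j)) := by
    simp only [avg, map_smul, map_sum, map_mul, map_pow]
    rfl
  rw [h]
  change Matrix.diagonal _ = _
  congr 1
  funext k
  have h : avg d (hπ.tVal i) (hπ.tVal j) k = avg d (hπ.tVal i k) (hπ.tVal j k) := by
    simp [avg]
  have h1 : ∀ j, hπ.tVal j k * 1 = cst (val (act (π k) (chi1 ξ μ)) j) • 1 := fun j => by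
    rw [mul_one, tVal, Algebra.algebraMap_eq_smul_one]
  rw [h, ← mul_one (avg _ _ _), avg_mul_of_eigen (val_pow _ i) (val_pow _ j) (h1 i) (h1 j)]
  simp only [val_act_pi]

theorem gMat_quad [NeZero d] (i : Fin (n - 1)) : hπ.gMat i * hπ.gMat i =
    algebraMap K _ (u ^ 2) + v • (avg d (hπ.tMat (lo i)) (hπ.tMat (hi i)) * hπ.gMat i) := by
  rw [avg_tMat, diagonal_eq_mono, gMat, mono_mul_mono, mono_mul_mono, mono_smul,
    Matrix.algebraMap_eq_diagonal, diagonal_eq_mono]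
  ext k l
  simp only [Matrix.add_apply, mono_apply, Function.comp_apply, ← move_mul, s_mul_self, move_one,
    hπ.pi_inv_move, s_lo, s_hi, id]
  by_cases h : block μ ((π k)⁻¹ (lo i)) = block μ ((π k)⁻¹ (hi i))
  · simp only [h, if_true, hπ.move_of_eq h, one_mul]
    split_ifs
    · rw [gen_quad μ (hπ.neighbour k i) h]
      rfl
    · rw [add_zero]
  · simp only [h, if_false, zero_mul, smul_zero, ite_self, add_zero, gen_of_ne μ h,
      gen_of_ne μ (Ne.symm h), ← pow_two, Pi.algebraMap_apply, map_pow]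

/-- For `w` in the symmetric group and an index `k`, the element `π_k⁻¹ w π_j` of the Young
subgroup, where `j` is the index with `w(χ_j) = χ_k`. -/
def cocycle (w : Equiv.Perm (Fin n)) (k : Fin (m ξ μ)) : young μ :=
  ⟨(π k)⁻¹ * w * π (hπ.move w⁻¹ k), by
    have h := hπ.move_spec w (hπ.move w⁻¹ k)
    rwa [← move_mul, mul_inv_cancel, move_one, ← mul_assoc] at h⟩

variable [NeZero d]

/-- The representation of the Yokonuma-Hecke algebra by matrices over `H^μ`, whose restriction to
`E_μ Y_{d,n}` is `Ψ_μ`. -/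
def rep : Yok d n →ₐ[K] Matrix (Fin (m ξ μ)) (Fin (m ξ μ)) (Hmu μ) :=
  RingQuot.liftAlgHom K ⟨FreeAlgebra.lift K (YGen.rec hπ.gMat hπ.tMat), by
    have hg : ∀ i, FreeAlgebra.lift K (YGen.rec hπ.gMat hπ.tMat) (Free.g i) = hπ.gMat i :=
      fun i => FreeAlgebra.lift_ι_apply _ _
    have ht : ∀ j, FreeAlgebra.lift K (YGen.rec hπ.gMat hπ.tMat) (Free.t j) = hπ.tMat j :=
      fun j => FreeAlgebra.lift_ι_apply _ _
    rintro _ _ (⟨i, j, h⟩ | ⟨i, j, h⟩ | ⟨i, j⟩ | ⟨i, j⟩ | ⟨j⟩ | ⟨i⟩)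
    · simp only [map_mul, hg]
      rcases h with h | h
      · exact hπ.gMat_comm i j h
      · exact (hπ.gMat_comm j i h).symm
    · simpa only [map_mul, hg] using hπ.gMat_braid i j h
    · simpa only [map_mul, ht] using hπ.tMat_comm i j
    · simpa only [map_mul, hg, ht] using hπ.gMat_mul_tMat i j
    · simpa only [map_pow, map_one, ht] using hπ.tMat_pow j
    · simpa only [map_pow, map_add, map_smul, map_mul, AlgHom.commutes, map_free_e, hg, ht, pow_two]
        using hπ.gMat_quad i⟩

theorem rep_g (i : Fin (n - 1)) : hπ.rep (g d i) = hπ.gMat i :=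
  (RingQuot.liftAlgHom_mkAlgHom_apply K _ _ _).trans (FreeAlgebra.lift_ι_apply _ _)

theorem rep_t (j : Fin n) : hπ.rep (t d j) = hπ.tMat j :=
  (RingQuot.liftAlgHom_mkAlgHom_apply K _ _ _).trans (FreeAlgebra.lift_ι_apply _ _)

open scoped Classical in
theorem rep_E (χ : Chr d n) : hπ.rep (E χ) =
    Matrix.diagonal fun k => if χ = act (π k) (chi1 ξ μ) then (1 : Hmu μ) else 0 := by
  rw [E_eq_charProj, map_charProj]
  have h : hπ.rep ∘ t d = Matrix.diagonalAlgHom K ∘ hπ.tVal := funext hπ.rep_t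
  rw [h, ← map_charProj]
  change Matrix.diagonal _ = _
  congr 1
  funext k
  have h1 : charProj χ hπ.tVal k = charProj χ (Pi.evalAlgHom K _ k ∘ hπ.tVal) :=
    map_charProj (Pi.evalAlgHom K (fun _ : Fin (m ξ μ) => Hmu μ) k) χ hπ.tVal
  rw [h1, ← mul_one (charProj _ _)]
  refine charProj_mul_of_eigen χ _ fun j => ?_
  rw [mul_one, ← Algebra.algebraMap_eq_smul_one]
  rfl

/-- Multiplying `g̃_w` by `g̃_i` on the left either renames the row index and leaves the element of
the Young subgroup unchanged, or multiplies this element by a simple transposition; the order of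
`w⁻¹ i` and `w⁻¹ (i+1)`, which tells whether the length increases, is preserved by
standardization. -/
theorem rep_gt (w : Equiv.Perm (Fin n)) :
    hπ.rep (gt d w) = mono (hπ.move w⁻¹) fun k => TtYoung μ (hπ.cocycle w k) := by
  induction w using perm_induction with
  | one =>
    rw [gt_one, map_one, ← Matrix.diagonal_one, diagonal_eq_mono]
    refine mono_congr (fun k => ?_) fun k => Subtype.ext ?_
    · rw [inv_one, move_one, id]
    · simp only [TtYoung, cocycle, inv_one, move_one, mul_one, inv_mul_cancel, Tt_one]
      rfl
  | step i w h ih =>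
    rw [gt_s_mul h, map_smul, map_mul, ih, rep_g, gMat, mono_mul_mono, mono_smul]
    refine mono_congr (fun k => ?_) fun k => ?_
    · rw [mul_inv_rev, s_inv, move_mul, Function.comp_apply]
    · by_cases hb : block μ ((π k)⁻¹ (lo i)) = block μ ((π k)⁻¹ (hi i))
      · rcases gen_cases μ (hπ.neighbour k i) with ⟨hne, -⟩ | ⟨j, hj, h1, h2, e⟩
        · exact absurd hb hne
        rw [e, hπ.move_of_eq hb]
        apply Subtype.ext
        change uInv • (T j * Tt ((π k)⁻¹ * w * π (hπ.move w⁻¹ k))) =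
          Tt ((π k)⁻¹ * (s i * w) * π (hπ.move (s i * w)⁻¹ k))
        have hs : (π k)⁻¹ * s i = s j * (π k)⁻¹ := by
          rw [s_eq, s_eq, Equiv.mul_swap_eq_swap_mul, h1, h2]
        rw [mul_inv_rev, s_inv, move_mul, hπ.move_of_eq hb, ← mul_assoc, hs, mul_assoc (s j),
          mul_assoc (s j), Tt_s_mul]
        have hinv : ((π k)⁻¹ * w * π (hπ.move w⁻¹ k))⁻¹ =
            (π (hπ.move w⁻¹ k))⁻¹ * (w⁻¹ * π k) := by group
        rw [hinv]
        simp only [Equiv.Perm.mul_apply]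
        rw [h1, h2, apply_inv_apply, apply_inv_apply]
        refine hπ.pi_inv_lt _ ?_ h
        rw [hπ.block_move, hπ.block_move, inv_inv, apply_inv_apply, apply_inv_apply, hb]
      · rw [gen_of_ne μ hb, ← Algebra.smul_def, smul_smul, uInv_mul_u, one_smul]
        apply Subtype.ext
        change Tt ((π (hπ.move (s i) k))⁻¹ * w * π (hπ.move w⁻¹ (hπ.move (s i) k))) =
          Tt ((π k)⁻¹ * (s i * w) * π (hπ.move (s i * w)⁻¹ k))
        rw [mul_inv_rev, s_inv, move_mul, hπ.pi_move_of_ne hb, mul_inv_rev, s_inv, mul_assoc _ _ w]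

theorem rep_E_mul_gt (k : Fin (m ξ μ)) (w : Equiv.Perm (Fin n)) :
    hπ.rep (E (act (π k) (chi1 ξ μ)) * gt d w) =
      Matrix.single k (hπ.move w⁻¹ k) (TtYoung μ (hπ.cocycle w k)) := by
  classical
  rw [map_mul, rep_E, rep_gt, diagonal_eq_mono, mono_mul_mono]
  ext a b
  rw [mono_apply, Matrix.single_apply]
  simp only [hπ.act_pi_chi1_injective.eq_iff, Function.comp_apply, id]
  by_cases ha : k = a
  · subst ha; simp [eq_comm]
  · simp [ha]

theorem rep_E_mul_gt_of_notMem {χ : Chr d n} (h : χ ∉ orbit ξ μ) (w : Equiv.Perm (Fin n)) :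
    hπ.rep (E χ * gt d w) = 0 := by
  classical
  rw [map_mul, rep_E]
  have h0 : ∀ k, χ ≠ act (π k) (chi1 ξ μ) := by
    rintro k rfl
    exact h (act_chi1_mem_orbit ξ μ _)
  simp only [h0, if_false]
  rw [Matrix.diagonal_zero, zero_mul]

end IsDistinguished

end Representation

/-! ### The inverse of the matrix representation -/

section Inverse

variable {d n : ℕ} {ξ : Fin d ≃ rootsOfUnity d ℂ} {μ : Comp d n}

namespace IsDistinguished

variable {π : Fin (m ξ μ) → Equiv.Perm (Fin n)} (hπ : IsDistinguished ξ μ π)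

theorem move_conj (i j : Fin (m ξ μ)) (w : young μ) :
    hπ.move (π i * (w : Equiv.Perm (Fin n)) * (π j)⁻¹)⁻¹ i = j := by
  refine hπ.move_inv_eq.2 (hπ.move_eq ?_)
  rw [inv_mul_cancel_right, inv_mul_cancel_left]
  exact w.2

theorem cocycle_conj (i j : Fin (m ξ μ)) (w : young μ) :
    hπ.cocycle (π i * (w : Equiv.Perm (Fin n)) * (π j)⁻¹) i = w := by
  refine Subtype.ext ?_
  simp only [cocycle, move_conj]
  group

theorem act_conj_chi1 (hπ : IsDistinguished ξ μ π) (i j : Fin (m ξ μ)) (w : young μ) :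
    act (π i * (w : Equiv.Perm (Fin n)) * (π j)⁻¹) (act (π j) (chi1 ξ μ)) =
      act (π i) (chi1 ξ μ) := by
  rw [hπ.act_pi_chi1, hπ.move_inv_eq.1 (hπ.move_conj i j w)]

/-- The linear map `Φ_μ`, with values in the whole Yokonuma-Hecke algebra. -/
def phi (_hπ : IsDistinguished ξ μ π) :
    Matrix (Fin (m ξ μ)) (Fin (m ξ μ)) (Hmu μ) →ₗ[K] Yok d n :=
  ((youngBasis μ).matrix (Fin (m ξ μ)) (Fin (m ξ μ))).constr K fun p =>
    E (act (π p.1) (chi1 ξ μ)) * gt d (π p.1 * (p.2.2 : Equiv.Perm (Fin n)) * (π p.2.1)⁻¹)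

theorem phi_single (i j : Fin (m ξ μ)) (w : young μ) :
    hπ.phi (Matrix.single i j (youngBasis μ w)) =
      E (act (π i) (chi1 ξ μ)) * gt d (π i * (w : Equiv.Perm (Fin n)) * (π j)⁻¹) := by
  rw [← Module.Basis.matrix_apply, phi, Module.Basis.constr_basis]

end IsDistinguished

variable [NeZero d]

theorem Emu_mul_E {χ : Chr d n} (h : χ ∈ orbit ξ μ) : Emu ξ μ * E χ = E χ := by
  classical
  rw [Emu, Finset.sum_mul]
  simp only [E_mul_E]
  rw [Finset.sum_ite_eq' _ χ, if_pos (Finset.mem_filter.2 ⟨Finset.mem_univ _, h⟩)]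

namespace IsDistinguished

variable {π : Fin (m ξ μ) → Equiv.Perm (Fin n)} (hπ : IsDistinguished ξ μ π)

theorem phi_single_eq_mul_E (i j : Fin (m ξ μ)) (w : young μ) :
    hπ.phi (Matrix.single i j (youngBasis μ w)) =
      E (act (π i) (chi1 ξ μ)) * gt d (π i * (w : Equiv.Perm (Fin n)) * (π j)⁻¹) *
        E (act (π j) (chi1 ξ μ)) := by
  rw [phi_single, mul_assoc (E _), gt_mul_E, hπ.act_conj_chi1, ← mul_assoc, E_mul_self]

theorem rep_phi (x : Matrix (Fin (m ξ μ)) (Fin (m ξ μ)) (Hmu μ)) : hπ.rep (hπ.phi x) = x := by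
  have h : hπ.rep.toLinearMap ∘ₗ hπ.phi = LinearMap.id := by
    refine ((youngBasis μ).matrix (Fin (m ξ μ)) (Fin (m ξ μ))).ext ?_
    rintro ⟨i, j, w⟩
    rw [Module.Basis.matrix_apply, LinearMap.comp_apply, phi_single, AlgHom.toLinearMap_apply,
      rep_E_mul_gt, move_conj, cocycle_conj, youngBasis_apply, LinearMap.id_apply]
  exact LinearMap.congr_fun h x

theorem phi_rep_E_mul_gt (k : Fin (m ξ μ)) (w : Equiv.Perm (Fin n)) :
    hπ.phi (hπ.rep (E (act (π k) (chi1 ξ μ)) * gt d w)) = E (act (π k) (chi1 ξ μ)) * gt d w := by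
  rw [rep_E_mul_gt, ← youngBasis_apply, phi_single]
  congr 2
  simp only [cocycle]
  group

theorem Emu_mul_phi (x : Matrix (Fin (m ξ μ)) (Fin (m ξ μ)) (Hmu μ)) :
    Emu ξ μ * hπ.phi x = hπ.phi x := by
  have h : LinearMap.mulLeft K (Emu ξ μ) ∘ₗ hπ.phi = hπ.phi := by
    refine ((youngBasis μ).matrix (Fin (m ξ μ)) (Fin (m ξ μ))).ext ?_
    rintro ⟨i, j, w⟩
    rw [Module.Basis.matrix_apply, LinearMap.comp_apply, phi_single, LinearMap.mulLeft_apply,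
      ← mul_assoc, Emu_mul_E (act_chi1_mem_orbit ξ μ _)]
  exact LinearMap.congr_fun h x

theorem rep_E_of_notMem {χ : Chr d n} (h : χ ∉ orbit ξ μ) : hπ.rep (E χ) = 0 := by
  have := hπ.rep_E_mul_gt_of_notMem h 1
  rwa [gt_one, mul_one] at this

theorem rep_Emu : hπ.rep (Emu ξ μ) = 1 := by
  classical
  rw [← map_one hπ.rep, ← sum_E, Emu, map_sum, map_sum]
  refine Finset.sum_subset (Finset.subset_univ _) fun χ _ h => hπ.rep_E_of_notMem fun h' => ?_
  exact h (Finset.mem_filter.2 ⟨Finset.mem_univ _, h'⟩)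

theorem rep_Emu_of_ne {ν : Comp d n} (h : ν ≠ μ) : hπ.rep (Emu ξ ν) = 0 := by
  classical
  rw [Emu, map_sum]
  refine Finset.sum_eq_zero fun χ hχ => hπ.rep_E_of_notMem fun h' => h ?_
  exact (existsUnique_mem_orbit ξ χ).unique (Finset.mem_filter.1 hχ).2 h'

/-- The linear map `Φ_μ`. -/
def PhiMu : Matrix (Fin (m ξ μ)) (Fin (m ξ μ)) (Hmu μ) →ₗ[K] EY ξ μ where
  toFun x := ⟨hπ.phi x, hπ.phi x, hπ.Emu_mul_phi x⟩
  map_add' x y := Subtype.ext (map_add _ x y)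
  map_smul' c x := Subtype.ext (map_smul _ c x)

/-- The linear map `Ψ_μ`, the restriction of the matrix representation. -/
def PsiMu : EY ξ μ →ₗ[K] Matrix (Fin (m ξ μ)) (Fin (m ξ μ)) (Hmu μ) where
  toFun y := hπ.rep y
  map_add' x y := map_add _ (x : Yok d n) y
  map_smul' c x := map_smul _ c (x : Yok d n)

theorem PsiMu_apply (y : EY ξ μ) : hπ.PsiMu y = hπ.rep y := rfl

theorem PsiMu_PhiMu (x : Matrix (Fin (m ξ μ)) (Fin (m ξ μ)) (Hmu μ)) :
    hπ.PsiMu (hπ.PhiMu x) = x :=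
  hπ.rep_phi x

theorem PsiMu_toEY (y : Yok d n) : hπ.PsiMu (toEY ξ μ y) = hπ.rep y := by
  rw [PsiMu_apply, toEY, map_mul, rep_Emu, one_mul]

end IsDistinguished

variable {π : ∀ μ : Comp d n, Fin (m ξ μ) → Equiv.Perm (Fin n)}

/-- The representations for all `μ` together are inverted by the sum of the maps `Φ_μ`: both sides
are linear, and on a spanning element `E_χ g̃_w` only the composition `μ` with `χ ∈ O(μ)`
contributes. -/
theorem sum_phi_rep (hπ : ∀ μ : Comp d n, IsDistinguished ξ μ (π μ)) (y : Yok d n) :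
    ∑ μ, (hπ μ).phi ((hπ μ).rep y) = y := by
  have h : ∑ μ, (hπ μ).phi ∘ₗ (hπ μ).rep.toLinearMap = LinearMap.id := by
    refine LinearMap.ext_on span_E_mul_gt ?_
    rintro _ ⟨⟨χ, w⟩, rfl⟩
    obtain ⟨μ, hμ, huniq⟩ := existsUnique_mem_orbit ξ χ
    rw [LinearMap.sum_apply, Finset.sum_eq_single μ]
    · obtain ⟨k, rfl⟩ := (hπ μ).exists_act_pi_chi1 hμ
      exact (hπ μ).phi_rep_E_mul_gt k w
    · intro ν _ hν
      rw [LinearMap.comp_apply, AlgHom.toLinearMap_apply,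
        (hπ ν).rep_E_mul_gt_of_notMem fun h' => hν (huniq ν h'), map_zero]
    · exact fun h => absurd (Finset.mem_univ _) h
  have := LinearMap.congr_fun h y
  rwa [LinearMap.sum_apply] at this

theorem PhiMu_PsiMu (hπ : ∀ μ : Comp d n, IsDistinguished ξ μ (π μ)) (μ : Comp d n)
    (y : EY ξ μ) : (hπ μ).PhiMu ((hπ μ).PsiMu y) = y := by
  obtain ⟨_, y, rfl⟩ := y
  refine Subtype.ext ((Finset.sum_eq_single μ ?_ ?_).symm.trans (sum_phi_rep hπ (Emu ξ μ * y)))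
  · intro ν _ hν
    rw [map_mul, (hπ ν).rep_Emu_of_ne hν.symm, zero_mul, map_zero]
  · exact fun h => absurd (Finset.mem_univ _) h

theorem rep_phi_of_ne (hπ : ∀ μ : Comp d n, IsDistinguished ξ μ (π μ)) {μ ν : Comp d n}
    (h : ν ≠ μ) (x : Matrix (Fin (m ξ μ)) (Fin (m ξ μ)) (Hmu μ)) :
    (hπ ν).rep ((hπ μ).phi x) = 0 := by
  rw [← (hπ μ).Emu_mul_phi, map_mul, (hπ ν).rep_Emu_of_ne h.symm, zero_mul]

/-- The isomorphism given by the representations for all compositions together. -/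
def repEquiv (hπ : ∀ μ : Comp d n, IsDistinguished ξ μ (π μ)) :
    Yok d n ≃ₐ[K] ∀ μ : Comp d n, Matrix (Fin (m ξ μ)) (Fin (m ξ μ)) (Hmu μ) where
  toFun y μ := (hπ μ).rep y
  invFun x := ∑ μ, (hπ μ).phi (x μ)
  left_inv := sum_phi_rep hπ
  right_inv x := by
    funext ν
    change (hπ ν).rep (∑ μ, (hπ μ).phi (x μ)) = x ν
    rw [map_sum, Finset.sum_eq_single ν, (hπ ν).rep_phi]
    · exact fun μ _ h => rep_phi_of_ne hπ h.symm _
    · exact fun h => absurd (Finset.mem_univ _) h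
  map_mul' x y := funext fun μ => map_mul _ x y
  map_add' x y := funext fun μ => map_add _ x y
  commutes' c := funext fun μ => AlgHom.commutes _ c

/-- A matrix unit and an element of the Young subgroup correspond to an index and a
permutation. -/
def indexEquiv {μ : Comp d n} {π : Fin (m ξ μ) → Equiv.Perm (Fin n)}
    (hπ : IsDistinguished ξ μ π) :
    Fin (m ξ μ) × Fin (m ξ μ) × young μ ≃ Fin (m ξ μ) × Equiv.Perm (Fin n) where
  toFun p := (p.1, π p.1 * (p.2.2 : Equiv.Perm (Fin n)) * (π p.2.1)⁻¹)
  invFun p := (p.1, hπ.move p.2⁻¹ p.1, hπ.cocycle p.2 p.1)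
  left_inv := by
    rintro ⟨i, j, w⟩
    exact Prod.ext rfl (Prod.ext (hπ.move_conj i j w) (hπ.cocycle_conj i j w))
  right_inv := by
    rintro ⟨k, w⟩
    refine Prod.ext rfl ?_
    simp only [IsDistinguished.cocycle]
    group

/-- The basis of `E_μ Y_{d,n}` formed by the elements `E_{χ_k} g̃_w`. -/
def eyBasis (hπ : ∀ μ : Comp d n, IsDistinguished ξ μ (π μ)) (μ : Comp d n) :
    Module.Basis (Fin (m ξ μ) × Equiv.Perm (Fin n)) K (EY ξ μ) :=
  (((youngBasis μ).matrix (Fin (m ξ μ)) (Fin (m ξ μ))).map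
    (LinearEquiv.ofLinearMap (hπ μ).PhiMu (hπ μ).PsiMu (LinearMap.ext (PhiMu_PsiMu hπ μ))
      (LinearMap.ext (hπ μ).PsiMu_PhiMu))).reindex (indexEquiv (hπ μ))

theorem eyBasis_apply (hπ : ∀ μ : Comp d n, IsDistinguished ξ μ (π μ)) (μ : Comp d n)
    (k : Fin (m ξ μ)) (w : Equiv.Perm (Fin n)) :
    (eyBasis hπ μ (k, w) : Yok d n) = E (act (π μ k) (chi1 ξ μ)) * gt d w := by
  obtain ⟨⟨i, j, y⟩, h⟩ := (indexEquiv (hπ μ)).surjective (k, w)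
  rw [← h, eyBasis, Module.Basis.reindex_apply, Equiv.symm_apply_apply, Module.Basis.map_apply,
    Module.Basis.matrix_apply]
  refine ((hπ μ).phi_single i j y).trans ?_
  obtain ⟨rfl, rfl⟩ := Prod.mk.inj h
  rfl

end Inverse

end

end YokonumaHecke

open YokonumaHecke
theorem theorem3p1 (d n : ℕ) [NeZero d] (ξ : Fin d ≃ rootsOfUnity d ℂ)
    (π : ∀ μ : Comp d n, Fin (m ξ μ) → Equiv.Perm (Fin n))
    (hπ : ∀ μ : Comp d n, IsDistinguished ξ μ (π μ)) :
    -- `T_w` and `g_w` do not depend on the choice of a reduced expression of `w`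
    (∀ (w : Equiv.Perm (Fin n)) (l l' : List (Fin (n - 1))),
      IsReducedExpr l w → IsReducedExpr l' w → wordT l = wordT l' ∧ wordG d l = wordG d l') ∧
    -- `m_μ = n! / (μ_1! ⋯ μ_d!)`
    (∀ μ : Comp d n, m ξ μ * ∏ a, (μ.1 a)! = n !) ∧
    -- `H^μ` is naturally isomorphic to `H_{μ_1} ⊗ ⋯ ⊗ H_{μ_d}`
    (∀ μ : Comp d n, ∃ f : (⨂[K] a, Hecke (μ.1 a)) ≃ₐ[K] Hmu μ,
      ∀ (a : Fin d) (i : Fin (μ.1 a - 1)) (k : Fin (n - 1)),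
        (k : ℕ) = (∑ b ∈ Finset.Iio a, μ.1 b) + i →
          (f (PiTensorProduct.tprod K (Pi.mulSingle a (T i))) : Hecke n) = T k) ∧
    -- the characters `χ_k = π_k(χ_1)` are the elements of `O(μ)`, each listed once
    (∀ μ : Comp d n, Set.BijOn (fun k => act (π μ k) (chi1 ξ μ)) Set.univ (orbit ξ μ)) ∧
    -- the `T̃_w` form a basis of `H^μ`, and the `E_{χ_k} g̃_w` form a basis of `E_μ Y_{d,n}`
    ∃ (B : ∀ μ : Comp d n, Module.Basis (young μ) K (Hmu μ))
      (C : ∀ μ : Comp d n, Module.Basis (Fin (m ξ μ) × Equiv.Perm (Fin n)) K (EY ξ μ)),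
      (∀ μ (w : young μ), (B μ w : Hecke n) = Tt (w : Equiv.Perm (Fin n))) ∧
      (∀ μ k w, (C μ (k, w) : Yok d n) = E (act (π μ k) (chi1 ξ μ)) * gt d w) ∧
      ∃ (Φ : ∀ μ : Comp d n, Matrix (Fin (m ξ μ)) (Fin (m ξ μ)) (Hmu μ) →ₗ[K] EY ξ μ)
        (Ψ : ∀ μ : Comp d n, EY ξ μ →ₗ[K] Matrix (Fin (m ξ μ)) (Fin (m ξ μ)) (Hmu μ)),
        -- the formula defining `Φ_μ`
        (∀ μ i j (w : young μ), (Φ μ (Matrix.single i j (B μ w)) : Yok d n) =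
          E (act (π μ i) (chi1 ξ μ)) * gt d (π μ i * (w : Equiv.Perm (Fin n)) * (π μ j)⁻¹) *
            E (act (π μ j) (chi1 ξ μ))) ∧
        -- the formula defining `Ψ_μ`
        (∀ μ k w, ∃! j, act w (act (π μ j) (chi1 ξ μ)) = act (π μ k) (chi1 ξ μ)) ∧
        (∀ μ k w j, act w (act (π μ j) (chi1 ξ μ)) = act (π μ k) (chi1 ξ μ) →
          ∃ h : (π μ k)⁻¹ * w * π μ j ∈ young μ,
            Ψ μ (C μ (k, w)) = Matrix.single k j (B μ ⟨(π μ k)⁻¹ * w * π μ j, h⟩)) ∧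
        -- `Φ_μ` is a homomorphism of algebras, with inverse `Ψ_μ`; the unit of `E_μ Y_{d,n}` is `E_μ`
        (∀ μ x y, Φ μ (x * y) = Φ μ x * Φ μ y) ∧
        (∀ μ, (Φ μ 1 : Yok d n) = Emu ξ μ) ∧
        (∀ μ x, Ψ μ (Φ μ x) = x) ∧
        (∀ μ y, Φ μ (Ψ μ y) = y) ∧
        -- the direct sum of the `Φ_μ` is an isomorphism, with inverse the direct sum of the `Ψ_μ`
        ∃ Φn : (∀ μ : Comp d n, Matrix (Fin (m ξ μ)) (Fin (m ξ μ)) (Hmu μ)) ≃ₐ[K] Yok d n,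
          (∀ x, Φn x = ∑ μ, (Φ μ (x μ) : Yok d n)) ∧
          (∀ y μ, Φn.symm y μ = Ψ μ (toEY ξ μ y)) := by
  refine ⟨fun w l l' h h' => ⟨?_, ?_⟩, m_mul_prod_factorial ξ, fun μ => ?_, fun μ => ?_,
    youngBasis, eyBasis hπ, fun μ w => ?_, eyBasis_apply hπ, fun μ => (hπ μ).PhiMu,
    fun μ => (hπ μ).PsiMu, fun μ => (hπ μ).phi_single_eq_mul_E, fun μ k w => ?_,
    fun μ k w j h => ?_, fun μ x y => ?_, fun μ => ?_, fun μ => (hπ μ).PsiMu_PhiMu,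
    PhiMu_PsiMu hπ, (repEquiv hπ).symm, fun x => rfl, fun y μ => ((hπ μ).PsiMu_toEY y).symm⟩
  · exact prod_map_eq_of_isReducedExpr (fun i j h => T_comm i j (Or.inl h)) T_braid h h'
  · exact prod_map_eq_of_isReducedExpr g_comm g_braid h h'
  · refine ⟨AlgEquiv.ofBijective (tensorHom μ) (tensorHom_bijective μ), fun a i k hk => ?_⟩
    obtain rfl : k = blockIndex μ a i := Fin.ext hk
    exact congrArg Subtype.val (tensorHom_mulSingle μ a i)
  · exact ⟨fun k _ => act_chi1_mem_orbit ξ μ _, (hπ μ).act_pi_chi1_injective.injOn,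
      fun χ hχ => ((hπ μ).exists_act_pi_chi1 hχ).imp fun k hk => ⟨Set.mem_univ k, hk⟩⟩
  · rw [youngBasis_apply]; rfl
  · simp only [(hπ μ).act_pi_chi1, (hπ μ).act_pi_chi1_injective.eq_iff]
    exact ⟨_, (hπ μ).move_inv_eq.1 rfl, fun j h => ((hπ μ).move_inv_eq.2 h).symm⟩
  · rw [(hπ μ).act_pi_chi1] at h
    obtain rfl := (hπ μ).move_inv_eq.2 ((hπ μ).act_pi_chi1_injective h)
    refine ⟨((hπ μ).cocycle w k).2, ?_⟩
    rw [IsDistinguished.PsiMu_apply, eyBasis_apply, IsDistinguished.rep_E_mul_gt, youngBasis_apply]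
    rfl
  · have hmul : ∀ a b : EY ξ μ, (hπ μ).PsiMu (a * b) = (hπ μ).PsiMu a * (hπ μ).PsiMu b :=
      fun a b => map_mul (hπ μ).rep (a : Yok d n) b
    rw [← PhiMu_PsiMu hπ μ ((hπ μ).PhiMu x * (hπ μ).PhiMu y), hmul, (hπ μ).PsiMu_PhiMu,
      (hπ μ).PsiMu_PhiMu]
  · have h := (hπ μ).PsiMu_toEY 1
    rw [map_one] at h
    rw [← h, PhiMu_PsiMu hπ μ]
    exact mul_one _
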